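/- Let $K$ be a field. For $h,\tilde h,c\in K$ let $\mathcal F(h,\tilde h,c|z)=\sum_{n\ge 0}F_n(h,\tilde h,c)\,z^n$ be the (bare) Virasoro conformal block of four primary operators of equal dimension $h$ with exchange of the conformal family of dimension $\tilde h$ at central charge $c$: $F_n=\rho^{T}x$ with $Gx=\rho$, where $G$ is the level-$n$ Gram matrix of the Verma module in the basis $L_{-k_1}\cdots L_{-k_r}|\tilde h\rangle$, $k_1\ge\dots\ge k_r\ge1$, $\sum_i k_i=n$, and $\rho_{k_1\dots k_r}=\prod_{i=1}^r\big(\tilde h+\sum_{j>i}k_j+(k_i-1)h\big)$ are the three-point coefficients. The vacuum block is the case $\tilde h=0$ (exchange of the identity family). Fix $\delta\in\mathbb R$. For $\alpha\in\mathbb Q$ let $\dot f^{(\alpha)}(\delta,c|z)=\log\mathcal F(\delta c^{\alpha},0,c|z)$, regarded as a formal power series in $z$ whose coefficients are expanded near $c=\infty$ as Puiseux series in $c$, and let $\dot f^{(\alpha)}_a(z)$ be the coefficient of $c^a$ in it. The $\alpha$-heavy classical vacuum block is the principal part $\dot{\mathcal S}^{(\alpha)}(\delta,c|z)=\sum_{a\ge0}\dot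 f^{(\alpha)}_a(z)\,c^a$, the term $a=0$ included. The following identities hold as identities of formal power series in $z$. 1. (Vacuum block reconstruction.) For every integer $M\ge1$ and every rational $\alpha\in\big[\frac{M-1}{M},\frac{M}{M+1}\big)$, $$\dot{\mathcal S}^{(\alpha)}(\delta,c|z)=\sum_{m=1}^{M-1}\dot f_0^{(m/(m+1))}(z)\;c^{(m+1)\alpha-m}.$$ So the classical vacuum blocks for all rational $\alpha\in(0,1)$ are completely determined by the isolated coefficients, that is, by the $c^0$-coefficients $\dot f_0^{(m/(m+1))}$ at the exceptional points $\alpha=\frac{m}{m+1}$, $m=1,2,\dots$ 2. For every integer $M\ge2$ and every rational $\alpha\in\big(\frac{M-1}{M},\frac{M}{M+1}\big]$, the power $c^{M\alpha-(M-1)}$ is the minimal one of non-zero degree that can occur in $\dot{\mathcal S}^{(\alpha)}$ (if $a>0$ and $\dot f^{(\alpha)}_a\ne0$, then $a\ge M\alpha-(M-1)$), and its coefficient is $$\dot f^{(\alpha)}_{M\alpha-(M-1)}=\dot f_0^{((M-1)/M)}.$$ 3. The first isolated coefficient is $\dot f_0^{(1/2)}=2\delta^2z^2\,{}_2F_1(2,2;4;z)$.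 -/

import Mathlib

namespace VirasoroBlock

noncomputable section

/-! ### Verma modules, Gram matrices and conformal blocks over a field -/

section Block

variable {K : Type*} [Field K]

/-- The vector `L_{-k₁} L_{-k₂} ⋯ L_{-kᵣ} |h̃⟩` is represented by the word `[k₁, k₂, …, kᵣ]`.
`actWord c h' w n` is the result of applying `L_n` to the word `w` (here `h'` is the weight `h̃` of
the highest weight vector): a lowering operator (`n < 0`) is put in front of the word, while `L_n`
with `n ≥ 0` is commuted to the right by
`[L_n, L_{-k}] = (n + k) L_{n-k} + (c / 12) (n³ - n) δ_{n,k}`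
until it meets the highest weight vector, where `L_0 |h̃⟩ = h̃ |h̃⟩` and `L_n |h̃⟩ = 0` for `n > 0`.
The relations among the lowering operators are never used, so the result is a formal combination of
words that represents the vector `L_n w` of the Verma module. -/
def actWord (c h' : K) : List ℕ → ℤ → (List ℕ →₀ K)
  | [], n =>
    if n < 0 then Finsupp.single [n.natAbs] 1
    else if n = 0 then Finsupp.single [] h'
    else 0
  | k :: w, n =>
    if n < 0 then Finsupp.single (n.natAbs :: k :: w) 1
    else
      (actWord c h' w n).mapDomain (fun u => k :: u)
        + ((n : K) + (k : K)) • actWord c h' w (n - k)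
        + (if n = k then Finsupp.single w (c / 12 * ((n : K) ^ 3 - (n : K))) else 0)

/-- The operator `L_n`, acting on formal combinations of words. -/
def virL (c h' : K) (n : ℤ) : (List ℕ →₀ K) →ₗ[K] (List ℕ →₀ K) :=
  Finsupp.linearCombination K (fun w => actWord c h' w n)

/-- The Shapovalov (contravariant) form of two words,
`⟨h̃| L_{iᵣ} ⋯ L_{i₁} L_{-j₁} ⋯ L_{-jₛ} |h̃⟩` for `[i₁, …, iᵣ]` and `[j₁, …, jₛ]`, normalised by
`⟨h̃|h̃⟩ = 1`. -/
def shapovalov (c h' : K) (I J : List ℕ) : K :=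
  (I.foldl (fun v (i : ℕ) => virL c h' (i : ℤ) v) (Finsupp.single J 1)) []

/-- The word attached to a partition of `n`: its parts in non-increasing order. -/
def wordOf {n : ℕ} (p : Nat.Partition n) : List ℕ := p.parts.sort (· ≥ ·)

/-- The Gram matrix of the level `n` subspace of the Verma module of weight `h'` and central
charge `c`, in the basis `L_{-k₁} ⋯ L_{-kᵣ} |h̃⟩` with `k₁ ≥ ⋯ ≥ kᵣ ≥ 1` and `k₁ + ⋯ + kᵣ = n`. -/
def gram (c h' : K) (n : ℕ) : Matrix (Nat.Partition n) (Nat.Partition n) K :=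
  Matrix.of fun p q => shapovalov c h' (wordOf p) (wordOf q)

/-- The three-point coefficient
`⟨h| φ_h(1) L_{-k₁} ⋯ L_{-kᵣ} |h̃⟩ / ⟨h| φ_h(1) |h̃⟩`, which equals
`⟨h̃| L_{kᵣ} ⋯ L_{k₁} φ_h(1) |h⟩ / ⟨h̃| φ_h(1) |h⟩`.
By `[L_m, φ_h(z)] = z^m (z ∂_z + (m + 1) h) φ_h(z)` the operator `L_{-k}` standing in front of a
vector of weight `h̃ + N` contributes the factor `h̃ + N + (k - 1) h`. -/
def threePoint (h h' : K) : List ℕ → K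
  | [] => 1
  | k :: w => (h' + (w.sum : K) + ((k : K) - 1) * h) * threePoint h h' w

/-- The three-point coefficients at level `n` as a vector. -/
def threePointVec (h h' : K) (n : ℕ) : Nat.Partition n → K :=
  fun p => threePoint h h' (wordOf p)

open Classical in
/-- The level `n` coefficient `F_n(h, h̃, c)` of the conformal block of four operators of weight `h`
with the exchange of the conformal family of weight `h̃`: it is `ρᵀ x`, where `ρ` is the vector of
three-point coefficients and `x` a solution of `G x = ρ` for the Gram matrix `G`. As `G` is
symmetric, `ρᵀ x` does not depend on the solution; it is `ρᵀ G⁻¹ ρ` if `G` is invertible. For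
`h̃ = 0`, where the null vectors `⋯ L_{-1} |0⟩` have zero three-point coefficients, it is the
coefficient of the exchange of the identity family, in which `L_{-1} |0⟩ = 0`, and it is the value
of the rational function `ρᵀ G⁻¹ ρ` at `h̃ = 0`. -/
def blockCoeff (h h' c : K) (n : ℕ) : K :=
  if hx : ∃ x : Nat.Partition n → K, (gram c h' n).mulVec x = threePointVec h h' n then
    threePointVec h h' n ⬝ᵥ hx.choose
  else 0

/-- The (bare) conformal block `F(h, h̃, c | z) = ∑ F_n(h, h̃, c) zⁿ` as a power series in `z`. -/
def block (h h' c : K) : PowerSeries K := PowerSeries.mk (blockCoeff h h' c)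

end Block

/-! ### Expansions near `c = ∞` -/

/-- Formal series in rational powers of the central charge near `c = ∞`, with
real coefficients. The Hahn variable is `1 / c`, so that the power `c ^ a` has exponent `-a`; rational
functions of `c` and `c ^ α` are elements of this field through their expansions near `c = ∞`, which
are Puiseux series. -/
abbrev LargeC : Type := HahnSeries ℚ ℝ

/-- The power `c ^ a` of the central charge. -/
def cPow (a : ℚ) : LargeC := HahnSeries.single (-a) 1

/-- The principal part: all terms with non-negative powers of `c`, the `c ^ 0` term included. -/
def prin (x : LargeC) : LargeC where
  coeff a := if a ≤ 0 then x.coeff a else 0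
  isPWO_support' := x.isPWO_support.mono (by
    intro a ha
    simp only [Function.mem_support, ne_eq, ite_eq_right_iff, not_forall] at ha
    obtain ⟨_, h⟩ := ha
    exact h)

/-- The vacuum block of four operators of weight `h = δ c ^ α`, with `h̃ = 0`. -/
def vacuumBlock (δ : ℝ) (α : ℚ) : PowerSeries LargeC :=
  block (HahnSeries.C δ * cPow α) 0 (cPow 1)

/-- The logarithmic vacuum block. -/
def logVacuumBlock (δ : ℝ) (α : ℚ) : PowerSeries LargeC :=
  PowerSeries.logOf (vacuumBlock δ α)

/-- The coefficient of `c ^ a` in the large-`c` expansion of the logarithmic vacuum block with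
heaviness parameter `α`, as a power series in `z`. -/
def vacuumCoeff (δ : ℝ) (α a : ℚ) : PowerSeries ℝ :=
  PowerSeries.mk fun n => (PowerSeries.coeff n (logVacuumBlock δ α)).coeff (-a)

/-- The `α`-heavy classical vacuum block: the principal part at `c = ∞` of the logarithmic vacuum
block. -/
def classicalVacuumBlock (δ : ℝ) (α : ℚ) : PowerSeries LargeC :=
  PowerSeries.mk fun n => prin (PowerSeries.coeff n (logVacuumBlock δ α))

/-- The isolated coefficient: the `c ^ 0` term at the exceptional point `α = m / (m + 1)`. -/
def isolatedCoeff (δ : ℝ) (m : ℕ) : PowerSeries ℝ :=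
  vacuumCoeff δ ((m : ℚ) / (m + 1)) 0

/-- The Gauss hypergeometric series `₂F₁(a, b; c; z)` as a formal power series in `z`. -/
def hypergeometric (a b c : ℝ) : PowerSeries ℝ :=
  PowerSeries.mk (ordinaryHypergeometricCoefficient a b c)

end

end VirasoroBlock

namespace VirasoroBlock

noncomputable section

/-! ### The shuffle algebra of functions on words -/

/-! The theorem follows from the exponentiation of the block. With `h = ε c`, `log F` is `c` times a
power series in `z` whose coefficients are polynomials in `ε` over the power series in `1 / c`, with
no terms of degree 0 or 1 in `ε` (`exists_block_eq`, `exists_expansion`). At `ε = δ c ^ (α - 1)` the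
`ε ^ k` term produces only the powers `c ^ (k α - k + 1 - j)` with `j ≥ 0`. For `α < 1` and `k ≥ 2`
the exponent `k α - k + 1` is below 1, so a non-negative power forces `j = 0`. Its coefficient `δ ^
k v_k(z)` does not depend on `α`, and it is the `c ^ 0` coefficient at `α = (k - 1) / k`. The first
two claims are then a comparison of exponents. For the third, `v_2` comes from the one-letter words
alone: `L_{-n}` has norm `c (n ^ 3 - n) / 12` and three-point coefficient `(n - 1) h`, which gives
`12 (n - 1) / (n (n + 1))` (`constantCoeff_quadratic`).

Exponentiation rests on tensor products of Virasoro representations, in which central charges and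
external weights add. Functions on words form a commutative ring under the shuffle product, dual to
the coproduct with primitive letters. In it the Shapovalov form is multiplicative in `c`
(`shapFun_mul`) and the three-point coefficients are multiplicative in `h` (`vertexFun_add`). Their
logarithmic derivatives are additive and polynomial in the parameter, hence linear (`ketD_form`,
`exists_derivation_vertex`): both objects behave like exponentials `exp (c S)` and `exp (h S)`.

The remaining point is that contraction with the inverse Gram matrix preserves this exponential
shape. It is realised as a flow in `z` generated by differential operators in `a D_k` with `a = 1 /
c`. A WKB argument (`regular_logDeriv`) shows that such a flow keeps `a` times logarithmic
derivatives regular in `1 / c`. The symbols are chosen level by level so that the flow carries the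
form to the three-point coefficients (`exists_flow_form_eq_vertex`); this is possible because the
rescaled Gram matrix is invertible over power series in `1 / c` (`isUnit_det_gramSeries`). The same
flow applied to the three-point coefficients yields the block (`exists_block_logDeriv`). -/

/-- The additive derivations of a commutative ring. -/
abbrev Der (R : Type*) [CommRing R] := Derivation ℤ R R

theorem Der.leibniz {R : Type*} [CommRing R] (d : Der R) (f g : R) :
    d (f * g) = f * d g + g * d f := Derivation.leibniz d f g

/-- Functions on words, with the shuffle product. -/
structure Shuffle (K : Type*) where
  /-- the value at a word -/
  toFun : List ℕ → K

namespace Shuffle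

variable {K K' : Type*}

instance : CoeFun (Shuffle K) fun _ => List ℕ → K := ⟨toFun⟩

@[simp] theorem mk_apply (f : List ℕ → K) (w : List ℕ) : (mk f) w = f w := rfl

@[ext] theorem ext {f g : Shuffle K} (h : ∀ w, f w = g w) : f = g := by
  cases f; cases g; exact congrArg mk (funext h)

/-- The function `w ↦ f (k :: w)`. -/
def shift (k : ℕ) (f : Shuffle K) : Shuffle K := mk fun w => f (k :: w)

@[simp] theorem shift_apply (k : ℕ) (f : Shuffle K) (w : List ℕ) : shift k f w = f (k :: w) := rfl

/-- The value of the shuffle product at a word. -/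
def mulAt [Mul K] [Add K] : List ℕ → Shuffle K → Shuffle K → K
  | [], f, g => f [] * g []
  | k :: w, f, g => mulAt w (shift k f) g + mulAt w f (shift k g)

variable [CommRing K] [CommRing K']

instance : Add (Shuffle K) := ⟨fun f g => mk fun w => f w + g w⟩
instance : Neg (Shuffle K) := ⟨fun f => mk fun w => -f w⟩
instance : Zero (Shuffle K) := ⟨mk fun _ => 0⟩
instance : Mul (Shuffle K) := ⟨fun f g => mk fun w => mulAt w f g⟩

@[simp] theorem add_apply (f g : Shuffle K) (w : List ℕ) : (f + g) w = f w + g w := rfl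
@[simp] theorem zero_apply (w : List ℕ) : (0 : Shuffle K) w = 0 := rfl
@[simp] theorem shift_add (k : ℕ) (f g : Shuffle K) : shift k (f + g) = shift k f + shift k g := rfl
@[simp] theorem shift_zero (k : ℕ) : shift k (0 : Shuffle K) = 0 := rfl

instance : AddCommGroup (Shuffle K) where
  add_assoc f g h := ext fun w => add_assoc _ _ _
  zero_add f := ext fun w => zero_add _
  add_zero f := ext fun w => add_zero _
  neg_add_cancel f := ext fun w => neg_add_cancel _
  add_comm f g := ext fun w => add_comm _ _
  nsmul := nsmulRec
  zsmul := zsmulRec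

@[simp] theorem sub_apply (f g : Shuffle K) (w : List ℕ) : (f - g) w = f w - g w := by
  rw [sub_eq_add_neg, sub_eq_add_neg]; rfl

theorem mul_nil (f g : Shuffle K) : (f * g) [] = f [] * g [] := rfl

theorem mul_cons (f g : Shuffle K) (k : ℕ) (w : List ℕ) :
    (f * g) (k :: w) = (shift k f * g) w + (f * shift k g) w := rfl

theorem shift_mul (k : ℕ) (f g : Shuffle K) :
    shift k (f * g) = shift k f * g + f * shift k g := rfl

/-- The function supported on the empty word. -/
def const (a : K) : Shuffle K := mk fun w => if w = [] then a else 0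

@[simp] theorem const_nil (a : K) : const a [] = a := rfl
@[simp] theorem const_cons (a : K) (k : ℕ) (w : List ℕ) : const a (k :: w) = 0 := rfl
@[simp] theorem shift_const (k : ℕ) (a : K) : shift k (const a) = 0 := rfl

theorem mul_comm_aux (f g : Shuffle K) (w : List ℕ) : (f * g) w = (g * f) w := by
  induction w generalizing f g with
  | nil => simp only [mul_nil, mul_comm]
  | cons k w ih => rw [mul_cons, mul_cons, ih, ih f, add_comm]

theorem add_mul_aux (f g h : Shuffle K) (w : List ℕ) :
    ((f + g) * h) w = (f * h) w + (g * h) w := by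
  induction w generalizing f g h with
  | nil => simp only [mul_nil, add_apply, add_mul]
  | cons k w ih => rw [mul_cons, mul_cons, mul_cons, shift_add, ih, ih]; ring

theorem zero_mul_aux (f : Shuffle K) (w : List ℕ) : ((0 : Shuffle K) * f) w = 0 := by
  induction w generalizing f with
  | nil => simp [mul_nil]
  | cons k w ih => rw [mul_cons, shift_zero, ih, ih, add_zero]

theorem const_mul_apply (a : K) (f : Shuffle K) (w : List ℕ) : (const a * f) w = a * f w := by
  induction w generalizing f with
  | nil => simp [mul_nil]
  | cons k w ih => rw [mul_cons, shift_const, zero_mul_aux, zero_add, ih]; rfl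

theorem mul_assoc_aux (f g h : Shuffle K) (w : List ℕ) : (f * g * h) w = (f * (g * h)) w := by
  induction w generalizing f g h with
  | nil => simp only [mul_nil, mul_assoc]
  | cons k w ih =>
    rw [mul_cons, mul_cons, shift_mul, shift_mul, add_mul_aux, ih, ih, ih,
      mul_comm_aux f (_ + _), add_mul_aux, mul_comm_aux _ f, mul_comm_aux _ f]
    ring

instance : One (Shuffle K) := ⟨const 1⟩

instance : CommRing (Shuffle K) :=
  { (inferInstance : AddCommGroup (Shuffle K)), (inferInstance : Mul (Shuffle K)),
    (inferInstance : One (Shuffle K)) with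
    mul_comm := fun f g => ext (mul_comm_aux f g)
    mul_assoc := fun f g h => ext (mul_assoc_aux f g h)
    one_mul := fun f => ext fun w => by
      change (const 1 * f : Shuffle K) w = f w
      rw [const_mul_apply, one_mul]
    mul_one := fun f => ext fun w => by
      rw [mul_comm_aux]
      change (const 1 * f : Shuffle K) w = f w
      rw [const_mul_apply, one_mul]
    zero_mul := fun f => ext (zero_mul_aux f)
    mul_zero := fun f => ext fun w => by rw [mul_comm_aux]; exact zero_mul_aux f w
    right_distrib := fun f g h => ext (add_mul_aux f g h)
    left_distrib := fun f g h => ext fun w => by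
      rw [mul_comm_aux, add_mul_aux, mul_comm_aux _ f, mul_comm_aux _ f]; rfl }

@[simp] theorem one_nil : (1 : Shuffle K) [] = 1 := rfl
@[simp] theorem one_cons (k : ℕ) (w : List ℕ) : (1 : Shuffle K) (k :: w) = 0 := rfl

@[simp] theorem sum_apply {ι : Type*} (s : Finset ι) (f : ι → Shuffle K) (w : List ℕ) :
    (∑ i ∈ s, f i) w = ∑ i ∈ s, f i w := by
  classical
  induction s using Finset.induction_on with
  | empty => rfl
  | insert a s ha ih => rw [Finset.sum_insert ha, Finset.sum_insert ha, add_apply, ih]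

/-- Constants, as a ring homomorphism. -/
def C : K →+* Shuffle K where
  toFun := const
  map_one' := rfl
  map_zero' := by ext w; cases w <;> rfl
  map_add' a b := by ext w; cases w <;> simp
  map_mul' a b := by ext w; rw [const_mul_apply]; cases w <;> simp

@[simp] theorem C_mul_apply (a : K) (f : Shuffle K) (w : List ℕ) : (C a * f) w = a * f w :=
  const_mul_apply a f w

@[simp] theorem C_nil (a : K) : C a [] = a := rfl

@[simp] theorem C_cons (a : K) (k : ℕ) (w : List ℕ) : C a (k :: w) = 0 := rfl

@[simp] theorem natCast_mul_apply (n : ℕ) (f : Shuffle K) (w : List ℕ) :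
    ((n : Shuffle K) * f) w = n * f w := by
  rw [← map_natCast (C : K →+* Shuffle K), C_mul_apply]

/-- The value at the empty word. -/
def ev : Shuffle K →+* K where
  toFun f := f []
  map_one' := rfl
  map_zero' := rfl
  map_add' _ _ := rfl
  map_mul' _ _ := rfl

@[simp] theorem ev_apply (f : Shuffle K) : ev f = f [] := rfl

/-- Change of the ring of values. -/
def map (φ : K →+* K') : Shuffle K →+* Shuffle K' where
  toFun f := mk fun w => φ (f w)
  map_one' := by ext w; cases w <;> simp
  map_zero' := by ext w; simp
  map_add' f g := by ext w; simp
  map_mul' f g := by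
    ext w
    induction w generalizing f g with
    | nil => simp [mul_nil]
    | cons k w ih =>
      rw [mk_apply, mul_cons, mul_cons, map_add]
      exact congrArg₂ (· + ·) (ih (shift k f) g) (ih f (shift k g))

@[simp] theorem map_apply (φ : K →+* K') (f : Shuffle K) (w : List ℕ) : map φ f w = φ (f w) := rfl

/-- Restriction along a map of letters. -/
def pull (τ : ℕ → ℕ) : Shuffle K →+* Shuffle K where
  toFun f := mk fun w => f (w.map τ)
  map_one' := by ext w; cases w <;> rfl
  map_zero' := rfl
  map_add' _ _ := rfl
  map_mul' f g := by
    ext w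
    induction w generalizing f g with
    | nil => rfl
    | cons k w ih =>
      rw [mk_apply, List.map_cons, mul_cons, mul_cons]
      exact congrArg₂ (· + ·) (ih (shift (τ k) f) g) (ih f (shift (τ k) g))

@[simp] theorem pull_apply (τ : ℕ → ℕ) (f : Shuffle K) (w : List ℕ) : pull τ f w = f (w.map τ) := rfl

/-- A derivation from an additive map that satisfies the Leibniz rule. -/
def derivationOf {R : Type*} [CommRing R] (d : R →+ R)
    (h : ∀ f g, d (f * g) = d f * g + f * d g) : Der R :=
  Derivation.mk' d.toIntLinearMap fun f g => by
    simp only [AddMonoidHom.coe_toIntLinearMap, smul_eq_mul, h]; ring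

/-- Prepending a letter, as a derivation. -/
def shiftD (k : ℕ) : Der (Shuffle K) :=
  derivationOf ⟨⟨shift k, shift_zero k⟩, shift_add k⟩ (shift_mul k)

@[simp] theorem shiftD_apply (k : ℕ) (f : Shuffle K) : shiftD k f = shift k f := rfl

theorem derivation_mul_aux (d : Der K) (f g : Shuffle K) (w : List ℕ) :
    d ((f * g) w) = (mk (fun u => d (f u)) * g) w + (f * mk (fun u => d (g u))) w := by
  induction w generalizing f g with
  | nil => simp [mul_nil]; ring
  | cons k w ih =>
    rw [mul_cons, map_add, ih, ih, mul_cons, mul_cons, add_add_add_comm]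
    rfl

/-- A derivation of the ring of values, applied to all values. -/
def mapD (d : Der K) : Der (Shuffle K) :=
  derivationOf ⟨⟨fun f => mk fun w => d (f w), by ext w; simp⟩, fun f g => by ext w; simp⟩
    fun f g => by ext w; exact derivation_mul_aux d f g w

/-- The weight of a word, in which the letter `a` stands for `L_{-(a + 2)}`. -/
def wt (w : List ℕ) : ℕ := (w.map (· + 2)).sum

@[simp] theorem wt_nil : wt [] = 0 := rfl
@[simp] theorem wt_cons (k : ℕ) (w : List ℕ) : wt (k :: w) = k + 2 + wt w := rfl

theorem wt_append (v w : List ℕ) : wt (v ++ w) = wt v + wt w := by simp [wt]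

theorem wt_perm {v w : List ℕ} (h : v.Perm w) : wt v = wt w := (h.map _).sum_eq

/-- A shuffle product distributes the letters of the word over the two factors, and the weight is
additive over letters. -/
theorem wt_mul_aux (f g : Shuffle K) (w : List ℕ) :
    (wt w : K) * (f * g) w = (mk (fun u => wt u * f u) * g) w + (f * mk (fun u => wt u * g u)) w := by
  induction w generalizing f g with
  | nil => simp [mul_nil]
  | cons k w ih =>
    have e : ∀ f : Shuffle K, shift k (mk fun u => (wt u : K) * f u)
        = C ((k + 2 : ℕ) : K) * shift k f + mk fun u => wt u * (shift k f) u := by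
      intro f; ext u; simp only [shift_apply, add_apply, C_mul_apply, wt_cons]; push_cast; ring
    rw [mul_cons, mul_cons, mul_cons, e, e, add_mul, mul_add f, add_apply, add_apply,
      mul_assoc (C _), C_mul_apply, mul_left_comm f, C_mul_apply, wt_cons]
    have h1 := ih (shift k f) g
    have h2 := ih f (shift k g)
    push_cast at h1 h2 ⊢
    linear_combination h1 + h2

/-- The derivation multiplying the value at `w` by the weight of `w`. -/
def euler : Der (Shuffle K) :=
  derivationOf ⟨⟨fun f => mk fun w => wt w * f w, by ext w; simp⟩, fun f g => by ext w; simp [mul_add]⟩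
    fun f g => by ext w; exact wt_mul_aux f g w

@[simp] theorem euler_apply (f : Shuffle K) (w : List ℕ) : euler f w = wt w * f w := rfl

/-! ### Symmetrisation -/

/-- A function on words is symmetric if it does not depend on the order of the letters. -/
def IsSymm (f : Shuffle K) : Prop := ∀ v w : List ℕ, v.Perm w → f v = f w

theorem IsSymm.shift {K : Type*} {f : Shuffle K} (hf : IsSymm f) (k : ℕ) : IsSymm (shift k f) :=
  fun _ _ h => hf _ _ (h.cons k)

theorem IsSymm.mul {f g : Shuffle K} (hf : IsSymm f) (hg : IsSymm g) : IsSymm (f * g) := by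
  intro v w h
  induction h generalizing f g with
  | nil => rfl
  | cons k _ ih => rw [mul_cons, mul_cons, ih (hf.shift k) hg, ih hf (hg.shift k)]
  | swap a b l =>
    have e : ∀ {f : Shuffle K}, IsSymm f → Shuffle.shift a (Shuffle.shift b f)
      = Shuffle.shift b (Shuffle.shift a f) := fun hf => by
        ext u; exact hf _ _ (List.Perm.swap a b u)
    simp only [mul_cons, e hf, e hg]; ring
  | trans _ _ ih1 ih2 => rw [ih1 hf hg, ih2 hf hg]

/-- The letters of a word in non-increasing order. -/
def sortWord (w : List ℕ) : List ℕ := (w : Multiset ℕ).sort (· ≥ ·)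

@[simp] theorem sortWord_nil : sortWord [] = [] := by
  rw [sortWord, Multiset.coe_nil, Multiset.sort_zero]

theorem sortWord_perm (w : List ℕ) : (sortWord w).Perm w := by
  rw [← Multiset.coe_eq_coe]; exact Multiset.sort_eq _ _

theorem sortWord_eq_of_perm {v w : List ℕ} (h : v.Perm w) : sortWord v = sortWord w := by
  rw [sortWord, sortWord, Multiset.coe_eq_coe.2 h]

theorem pairwise_sortWord (w : List ℕ) : (sortWord w).Pairwise (· ≥ ·) :=
  Multiset.pairwise_sort _ _

theorem sortWord_of_pairwise {w : List ℕ} (h : w.Pairwise (· ≥ ·)) : sortWord w = w :=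
  (sortWord_perm w).eq_of_pairwise (fun _ _ _ _ h h' => le_antisymm h' h)
    (pairwise_sortWord w) h

/-- A shuffle product at a word reads its factors only at subwords. Subwords of a sorted word are
sorted, which is why sorting respects products. -/
theorem mul_congr_sublist {f f' g g' : Shuffle K} (w : List ℕ)
    (hf : ∀ u : List ℕ, u.Sublist w → f u = f' u) (hg : ∀ u : List ℕ, u.Sublist w → g u = g' u) :
    (f * g) w = (f' * g') w := by
  induction w generalizing f f' g g' with
  | nil => rw [mul_nil, mul_nil, hf _ (List.Sublist.refl _), hg _ (List.Sublist.refl _)]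
  | cons k w ih =>
    rw [mul_cons, mul_cons]
    congr 1
    · exact ih (fun u hu => hf _ (hu.cons_cons k)) (fun u hu => hg _ (hu.cons k))
    · exact ih (fun u hu => hf _ (hu.cons k)) (fun u hu => hg _ (hu.cons_cons k))

theorem isSymm_sort {K : Type*} (f : Shuffle K) : IsSymm (mk fun w => f (sortWord w)) :=
  fun _ _ h => by rw [mk_apply, mk_apply, sortWord_eq_of_perm h]

/-- The symmetric function with the same values at non-increasing words. -/
def symm : Shuffle K →+* Shuffle K where
  toFun f := mk fun w => f (sortWord w)
  map_one' := by
    ext w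
    rcases w with _ | ⟨k, w⟩
    · rw [mk_apply, sortWord, Multiset.coe_nil, Multiset.sort_zero]
    · have : sortWord (k :: w) ≠ [] := fun h => by
        have := (sortWord_perm (k :: w)); rw [h] at this; simpa using this.length_eq
      obtain ⟨a, b, h⟩ := List.exists_cons_of_ne_nil this
      rw [mk_apply, h]; rfl
  map_zero' := rfl
  map_add' _ _ := rfl
  map_mul' f g := by
    ext w
    rw [mk_apply, ((isSymm_sort f).mul (isSymm_sort g)) _ _ (sortWord_perm w).symm]
    have h : ∀ u : List ℕ, u.Sublist (sortWord w) → sortWord u = u := fun u hu =>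
      sortWord_of_pairwise ((pairwise_sortWord w).sublist hu)
    exact mul_congr_sublist _ (fun u hu => by simp only [h u hu]) (fun u hu => by simp only [h u hu])

theorem isSymm_symm (f : Shuffle K) : IsSymm (symm f) := isSymm_sort f

end Shuffle

open Shuffle

variable {K K' : Type*} [CommRing K] [CommRing K']

/-! ### The Virasoro action on functions on words -/

/-- The transpose of `L_n` on functions on words, for `h̃ = 0` and `c = 12 κ`, at a word. -/
def virAt (κ : K) : List ℕ → ℤ → Shuffle K → K
  | [], n, g => if n < 0 then g [n.natAbs] else 0
  | k :: w, n, g =>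
    if n < 0 then g (n.natAbs :: k :: w)
    else virAt κ w n (shift k g) + ((n : K) + (k : K)) * virAt κ w (n - k) g
      + (if n = k then κ * ((n : K) ^ 3 - (n : K)) * g w else 0)

/-- The transpose of `L_n` on functions on words. -/
def virOp (κ : K) (n : ℤ) (g : Shuffle K) : Shuffle K := mk fun w => virAt κ w n g

/-- The Shapovalov form with a given bra, as a function of the ket. -/
def shap (κ : K) : List ℕ → Shuffle K
  | [] => 1
  | i :: I => virOp κ i (shap κ I)

theorem virAt_add (κ : K) (w : List ℕ) (n : ℤ) (f g : Shuffle K) :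
    virAt κ w n (f + g) = virAt κ w n f + virAt κ w n g := by
  induction w generalizing n f g with
  | nil => simp only [virAt]; split_ifs <;> simp
  | cons k w ih =>
    simp only [virAt, shift_add, ih]
    split_ifs <;> simp <;> ring

theorem virOp_add (κ : K) (n : ℤ) (f g : Shuffle K) :
    virOp κ n (f + g) = virOp κ n f + virOp κ n g := ext fun w => virAt_add κ w n f g

theorem virOp_zero (κ : K) (n : ℤ) : virOp κ n 0 = 0 := by
  simpa using virOp_add κ n 0 0

theorem virOp_of_neg (κ : K) {n : ℤ} (hn : n < 0) (g : Shuffle K) :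
    virOp κ n g = shift n.natAbs g := by
  ext w; cases w <;> simp [virOp, virAt, hn]

theorem virOp_nil (κ : K) {n : ℤ} (hn : 0 ≤ n) (g : Shuffle K) : virOp κ n g [] = 0 := by
  simp [virOp, virAt, hn.not_gt]

theorem shift_virOp (κ : K) {n : ℤ} (hn : 0 ≤ n) (k : ℕ) (g : Shuffle K) :
    shift k (virOp κ n g) = virOp κ n (shift k g) + C ((n : K) + (k : K)) * virOp κ (n - k) g
      + C (if n = k then κ * ((n : K) ^ 3 - (n : K)) else 0) * g := by
  ext w
  simp only [shift_apply, Shuffle.add_apply, C_mul_apply]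
  simp only [virOp, mk_apply, virAt, hn.not_gt, if_false]
  split_ifs <;> simp

/-- This is the action of `L_n` on a tensor product: the modes are primitive, so their transposes
obey the Leibniz rule, and the central term splits because it is linear in the central charge. -/
theorem virOp_mul (κ κ' : K) (n : ℤ) (f g : Shuffle K) :
    virOp (κ + κ') n (f * g) = virOp κ n f * g + f * virOp κ' n g := by
  rcases lt_or_ge n 0 with hn | hn
  · rw [virOp_of_neg _ hn, virOp_of_neg _ hn, virOp_of_neg _ hn, shift_mul]
  ext w
  induction w generalizing n f g with
  | nil => simp [virOp_nil _ hn, mul_nil]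
  | cons k w ih =>
    have ih' : ∀ m f g, virOp (κ + κ') m (f * g) w = (virOp κ m f * g + f * virOp κ' m g) w := by
      intro m f g
      rcases lt_or_ge m 0 with hm | hm
      · rw [virOp_of_neg _ hm, virOp_of_neg _ hm, virOp_of_neg _ hm, shift_mul]
      · exact ih m f g hm
    change shift k (virOp (κ + κ') n (f * g)) w = shift k (virOp κ n f * g + f * virOp κ' n g) w
    rw [shift_virOp _ hn, shift_add, shift_mul, shift_mul, shift_mul, shift_virOp _ hn,
      shift_virOp _ hn, virOp_add, Shuffle.add_apply, Shuffle.add_apply, Shuffle.add_apply, ih', ih', C_mul_apply, ih',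
      C_mul_apply]
    simp only [add_mul, mul_add, Shuffle.add_apply, mul_assoc, C_mul_apply, mul_left_comm f (C _)]
    split_ifs <;> ring

theorem virOp_zero_one (n : ℤ) : virOp (0 : K) n 1 = 0 := by
  have h := virOp_mul (0 : K) 0 n 1 1
  simpa using h

/-- The Shapovalov form as a function of the bra and the ket. -/
def shapFun (κ : K) : Shuffle (Shuffle K) := mk (shap κ)

theorem virOp_mul_apply (κ κ' : K) (n : ℤ) (F G : Shuffle (Shuffle K)) (I : List ℕ) :
    (mk (fun J => virOp κ n (F J)) * G) I + (F * mk (fun J => virOp κ' n (G J))) I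
      = virOp (κ + κ') n ((F * G) I) := by
  induction I generalizing F G with
  | nil => simp only [mul_nil, virOp_mul]
  | cons i I ih =>
    rw [mul_cons, mul_cons, mul_cons, virOp_add, ← ih, ← ih, add_add_add_comm]
    rfl

/-- The form of a tensor product of highest weight vectors is the product of the forms. Prepending a
bra letter applies a transposed mode in the ket, and `virOp_mul` distributes that mode over the two
factors. -/
theorem shapFun_mul (κ κ' : K) : shapFun κ * shapFun κ' = shapFun (κ + κ') := by
  ext1 I
  induction I with
  | nil => exact mul_one _
  | cons i I ih =>
    rw [mul_cons]
    refine (virOp_mul_apply κ κ' i (shapFun κ) (shapFun κ') I).trans ?_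
    rw [ih]; rfl

/-- At central charge zero the modes are genuine derivations and kill the unit, so no non-empty bra
survives. -/
theorem shapFun_zero : shapFun (0 : K) = 1 := by
  have h : ∀ i I, shap (0 : K) (i :: I) = 0 := by
    intro i I
    induction I generalizing i with
    | nil => exact virOp_zero_one _
    | cons j I ih => rw [shap, ih, virOp_zero]
  ext1 I
  cases I with
  | nil => rfl
  | cons i I => exact h i I

theorem map_virAt (φ : K →+* K') (κ : K) (w : List ℕ) (n : ℤ) (g : Shuffle K) :
    φ (virAt κ w n g) = virAt (φ κ) w n (map φ g) := by
  induction w generalizing n g with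
  | nil => simp only [virAt]; split_ifs <;> simp
  | cons k w ih =>
    have e : map φ (shift k g) = shift k (map φ g) := rfl
    simp only [virAt]
    split_ifs <;> simp [ih, e]

theorem map_shap (φ : K →+* K') (κ : K) (I : List ℕ) : map φ (shap κ I) = shap (φ κ) I := by
  induction I with
  | nil => exact map_one _
  | cons i I ih =>
    ext w
    rw [shap, shap, ← ih]; exact map_virAt φ κ w i _

theorem shap_nil_right (κ : K) (i : ℕ) (I : List ℕ) : shap κ (i :: I) [] = 0 :=
  virOp_nil _ (Int.natCast_nonneg i) _

theorem shap_singleton (κ : K) {i j : ℕ} (hi : 0 < i) :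
    shap κ [i] [j] = if i = j then κ * ((i : K) ^ 3 - i) else 0 := by
  have h1 : ¬ ((i : ℤ) < 0) := by omega
  simp only [shap, virOp, mk_apply, virAt, h1, if_false]
  by_cases h : (i : ℤ) - j < 0
  · have h2 : ¬ i = j := by omega
    simp [h, h2]
  · simp [h]

/-! ### Level orthogonality and the null vector `L_{-1} |0⟩` -/

theorem virAt_eq_zero_of_sum (κ : K) (w : List ℕ) (n s : ℤ) (g : Shuffle K)
    (hg : ∀ u : List ℕ, (u.sum : ℤ) ≠ s → g u = 0) (hw : (w.sum : ℤ) ≠ s + n) :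
    virAt κ w n g = 0 := by
  induction w generalizing n s g with
  | nil =>
    simp only [virAt]
    split_ifs with h
    · refine hg _ ?_
      simp only [List.sum_cons, List.sum_nil] at hw ⊢
      omega
    · rfl
  | cons k w ih =>
    simp only [List.sum_cons] at hw
    simp only [virAt]
    split_ifs with h h'
    · refine hg _ ?_
      simp only [List.sum_cons]; omega
    · rw [ih n (s - k) (shift k g) (fun u hu => hg _ ?_) (by omega), ih (n - k) s g hg (by omega),
        hg w (by omega)]
      · ring
      · rw [List.sum_cons]; omega
    · rw [ih n (s - k) (shift k g) (fun u hu => hg _ ?_) (by omega), ih (n - k) s g hg (by omega)]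
      · ring
      · rw [List.sum_cons]; omega

theorem shap_eq_zero_of_sum (κ : K) (I J : List ℕ) (h : I.sum ≠ J.sum) : shap κ I J = 0 := by
  induction I generalizing J with
  | nil =>
    cases J with
    | nil => exact absurd rfl h
    | cons j J => rfl
  | cons i I ih =>
    refine virAt_eq_zero_of_sum κ J i I.sum (shap κ I) (fun u hu => ih u ?_) ?_
    · exact fun e => hu (by rw [e])
    · rw [List.sum_cons] at h
      omega

/-- Words ending in `L_{-1} |0⟩` are null. For the word `[1]` the two delicate modes are `n = 0`,
whose commutator returns the letter 1, and `n = 1`, where the central term `n ^ 3 - n` vanishes. -/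
theorem virAt_append_one (κ : K) (w : List ℕ) (n : ℤ) (g : Shuffle K)
    (hg : ∀ u : List ℕ, g (u ++ [1]) = 0) : virAt κ (w ++ [1]) n g = 0 := by
  induction w generalizing n g with
  | nil =>
    have h0 : g [1] = 0 := hg []
    simp only [List.nil_append, virAt]
    split_ifs with h1 h2 h3 h3
    · exact hg [_]
    all_goals first
      | omega
      | skip
    · have : n = 0 := by omega
      subst this; simp [h0]
    · subst h3; simp
    · simp
  | cons k w ih =>
    simp only [List.cons_append, virAt]
    rw [ih n (shift k g) (fun u => hg (k :: u)), ih (n - k) g hg, hg w]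
    have h1 : g (n.natAbs :: k :: (w ++ [1])) = 0 := hg (n.natAbs :: k :: w)
    rw [h1]
    split_ifs <;> ring

theorem shap_append_one_right (κ : K) (I J : List ℕ) : shap κ I (J ++ [1]) = 0 := by
  induction I generalizing J with
  | nil => cases J <;> rfl
  | cons i I ih => exact virAt_append_one κ J i _ ih

theorem virAt_zero_one (κ : K) (w : List ℕ) : virAt κ w 0 1 = 0 := by
  induction w with
  | nil => simp [virAt]
  | cons k w ih =>
    have e : shift k (1 : Shuffle K) = 0 := rfl
    have e' : virAt κ w 0 0 = 0 := congrArg (fun f : Shuffle K => f w) (virOp_zero κ 0)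
    rcases Nat.eq_zero_or_pos k with rfl | hk
    · simp [virAt, e, e']
    · have h1 : virAt κ w (0 - k) 1 = 0 := by
        have := virOp_of_neg κ (n := 0 - k) (by omega) 1
        exact congrArg (fun f : Shuffle K => f w) this
      simp only [virAt, lt_irrefl, if_false, e, e', h1]
      simp

theorem shap_one (κ : K) : shap κ [1] = 0 := by
  ext w
  change virAt κ w 1 1 = 0
  induction w with
  | nil => simp [virAt]
  | cons k w ih =>
    have e : shift k (1 : Shuffle K) = 0 := rfl
    have e' : virAt κ w 1 0 = 0 := congrArg (fun f : Shuffle K => f w) (virOp_zero κ 1)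
    have h1 : virAt κ w (1 - k) 1 = 0 := by
      rcases lt_trichotomy k 1 with h | rfl | h
      · obtain rfl : k = 0 := by omega
        simpa using ih
      · simpa using virAt_zero_one κ w
      · have := virOp_of_neg κ (n := 1 - k) (by omega) 1
        exact congrArg (fun f : Shuffle K => f w) this
    simp [virAt, e, e', h1]

theorem shap_append_one_left (κ : K) (I : List ℕ) : shap κ (I ++ [1]) = 0 := by
  induction I with
  | nil => exact shap_one κ
  | cons i I ih => rw [List.cons_append, shap, ih, virOp_zero]

/-! ### Identification with the Shapovalov form of the Verma module -/

section Field

variable {F : Type*} [Field F]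

/-- Both recursions commute `L_n` to the right by the same rule, so pairing with `g` turns the
action on words into its transpose. -/
theorem linearCombination_actWord (c : F) (w : List ℕ) (n : ℤ) (g : Shuffle F) :
    Finsupp.linearCombination F g.toFun (actWord c 0 w n) = virAt (c / 12) w n g := by
  induction w generalizing n g with
  | nil =>
    simp only [actWord, virAt]
    split_ifs <;> simp
  | cons k w ih =>
    simp only [actWord, virAt]
    split_ifs with h1 h2
    · simp
    · rw [map_add, map_add, map_smul, ih, Finsupp.linearCombination_mapDomain,
        Finsupp.linearCombination_single, smul_eq_mul, smul_eq_mul]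
      congr 2
      exact ih n (shift k g)
    · rw [map_add, map_add, map_smul, ih, Finsupp.linearCombination_mapDomain, map_zero, smul_eq_mul]
      congr 2
      exact ih n (shift k g)

theorem foldl_virL (c : F) (I : List ℕ) (v : List ℕ →₀ F) :
    (I.foldl (fun v (i : ℕ) => virL c 0 (i : ℤ) v) v) [] =
      Finsupp.linearCombination F (shap (c / 12) I).toFun v := by
  induction I generalizing v with
  | nil =>
    rw [List.foldl_nil, Finsupp.linearCombination_apply, Finsupp.sum]
    have : ∀ w, v w • (shap (c / 12) []).toFun w = if w = [] then v [] else 0 := by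
      intro w
      rcases w with _ | ⟨k, w⟩
      · exact mul_one _
      · exact mul_zero _
    simp only [this]
    simp
  | cons i I ih =>
    rw [List.foldl_cons, ih]
    induction v using Finsupp.induction_linear with
    | zero => simp
    | add f g hf hg => rw [map_add, map_add, map_add, hf, hg]
    | single w a =>
      rw [virL, Finsupp.linearCombination_single, map_smul, linearCombination_actWord,
        Finsupp.linearCombination_single]
      rfl

theorem shapovalov_eq (c : F) (I J : List ℕ) : shapovalov c 0 I J = shap (c / 12) I J := by
  rw [shapovalov, foldl_virL, Finsupp.linearCombination_single, one_smul]

end Field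

/-! ### Linearity of logarithmic derivatives in the central charge and in the external weight -/

/-- Additivity fixes the values at natural numbers, and a polynomial is determined by infinitely
many values. -/
theorem eval_of_additive {p : Polynomial ℝ} (h : ∀ a b, p.eval (a + b) = p.eval a + p.eval b)
    (a : ℝ) : p.eval a = a * p.eval 1 := by
  have hn : ∀ n : ℕ, p.eval (n : ℝ) = n * p.eval 1 := by
    intro n
    induction n with
    | zero => simpa using h 0 0
    | succ n ih => rw [Nat.cast_succ, h, ih]; ring
  obtain ⟨b, rfl⟩ : ∃ b, p = Polynomial.C b * Polynomial.X := by
    refine ⟨p.eval 1, Polynomial.eq_of_infinite_eval_eq _ _ (Set.Infinite.mono ?_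
      (Set.infinite_range_of_injective (Nat.cast_injective (R := ℝ))))⟩
    rintro _ ⟨n, rfl⟩
    simp only [Set.mem_ofPred_eq, hn n, Polynomial.eval_mul, Polynomial.eval_C, Polynomial.eval_X]
    ring
  simp only [Polynomial.eval_mul, Polynomial.eval_C, Polynomial.eval_X]
  ring

/-- Change of the ring of values for functions of two words. -/
def map₂ (φ : K →+* K') : Shuffle (Shuffle K) →+* Shuffle (Shuffle K') := Shuffle.map (Shuffle.map φ)

@[simp] theorem map₂_apply (φ : K →+* K') (F : Shuffle (Shuffle K)) (I J : List ℕ) :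
    map₂ φ F I J = φ (F I J) := rfl

/-- Restriction to words in the letters `L_{-k}` with `k ≥ 2`, in non-increasing order. -/
def normalize : Shuffle K →+* Shuffle K := symm.comp (pull (· + 2))

/-- The derivation by the ket letter `k`. -/
def ketD (k : ℕ) : Der (Shuffle (Shuffle K)) := mapD (shiftD k)

@[simp] theorem ketD_apply (k : ℕ) (F : Shuffle (Shuffle K)) (I J : List ℕ) :
    ketD k F I J = F I (k :: J) := rfl

section Form

variable [Algebra ℝ K] [Algebra ℝ K']

/-- The Shapovalov form on non-increasing words, as a function of the bra and the ket. -/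
def form (c : K) : Shuffle (Shuffle K) :=
  normalize (Shuffle.map normalize (shapFun (algebraMap ℝ K (1 / 12) * c)))

theorem form_apply (c : K) (I J : List ℕ) : form c I J =
    shap (algebraMap ℝ K (1 / 12) * c) ((sortWord I).map (· + 2)) ((sortWord J).map (· + 2)) := rfl

theorem form_add (a b : K) : form (a + b) = form a * form b := by
  rw [form, mul_add, ← shapFun_mul, map_mul, map_mul]; rfl

theorem form_zero : form (0 : K) = 1 := by
  rw [form, mul_zero, shapFun_zero, map_one, map_one]

theorem map_form (φ : K →+* K') (hφ : ∀ r, φ (algebraMap ℝ K r) = algebraMap ℝ K' r) (c : K) :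
    map₂ φ (form c) = form (φ c) := by
  ext I J
  rw [map₂_apply, form_apply, form_apply, ← Shuffle.map_apply, map_shap, map_mul, hφ]

theorem map_form_X (a : ℝ) : map₂ (Polynomial.evalRingHom a) (form Polynomial.X) = form a := by
  rw [map_form _ (by simp), Polynomial.coe_evalRingHom, Polynomial.eval_X]

theorem form_perm_left (c : K) {I I' : List ℕ} (h : I.Perm I') : form c I = form c I' := by
  ext J; rw [form_apply, form_apply, sortWord_eq_of_perm h]

theorem isSymm_form (c : K) (I : List ℕ) : IsSymm (form c I) := fun J J' h => by
  rw [form_apply, form_apply, sortWord_eq_of_perm h]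

theorem form_eq_zero_of_wt (c : K) {I J : List ℕ} (h : wt I ≠ wt J) : form c I J = 0 := by
  rw [form_apply]
  refine shap_eq_zero_of_sum _ _ _ ?_
  change wt (sortWord I) ≠ wt (sortWord J)
  rwa [wt_perm (sortWord_perm I), wt_perm (sortWord_perm J)]

/-- The logarithmic derivative of the Shapovalov form per unit of central charge. -/
def formLog (k : ℕ) : Shuffle (Shuffle ℝ) := ketD k (form 1) * form (-1)

/-- Since `form` is multiplicative in `c` with inverse `form (-c)`, its logarithmic derivative is
additive in `c`. Each entry is a polynomial in `c`, hence linear. -/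
theorem ketD_form_real (k : ℕ) (c : ℝ) :
    ketD k (form c) * form (-c) = C (C c) * formLog k := by
  have hinv : ∀ a : ℝ, form a * form (-a) = 1 := fun a => by
    rw [← form_add, add_neg_cancel, form_zero]
  have hadd : ∀ a b : ℝ, ketD k (form (a + b)) * form (-(a + b))
      = ketD k (form a) * form (-a) + ketD k (form b) * form (-b) := by
    intro a b
    rw [form_add, neg_add, form_add, Der.leibniz]
    linear_combination (ketD k (form b) * form (-b)) * hinv a
      + (ketD k (form a) * form (-a)) * hinv b
  ext I J
  let Q : Shuffle (Shuffle (Polynomial ℝ)) := ketD k (form Polynomial.X) * form (-Polynomial.X)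
  have hP : ∀ a : ℝ, (Q I J).eval a = (ketD k (form a) * form (-a)) I J := by
    intro a
    have h2 := map_form (Polynomial.evalRingHom a) (by simp) (-Polynomial.X)
    rw [map_neg, Polynomial.coe_evalRingHom, Polynomial.eval_X] at h2
    rw [← h2, ← map_form_X]
    have h3 : ketD k (map₂ (Polynomial.evalRingHom a) (form Polynomial.X))
      = map₂ (Polynomial.evalRingHom a) (ketD k (form Polynomial.X)) := rfl
    rw [h3, ← map_mul]
    rfl
  rw [← hP, eval_of_additive (fun a b => by rw [hP, hP, hP, hadd]; rfl), hP]
  simp [formLog]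

theorem ketD_form_poly (k : ℕ) : ketD k (form (Polynomial.X : Polynomial ℝ)) =
    C (C Polynomial.X) * (form Polynomial.X * map₂ Polynomial.C (formLog k)) := by
  have hinv : ∀ a : ℝ, form (-a) * form a = 1 := fun a => by
    rw [← form_add, neg_add_cancel, form_zero]
  ext I J : 2
  refine Polynomial.funext fun a => ?_
  have h2 := congrArg (· * form a) (ketD_form_real k a)
  simp only [mul_assoc, hinv, mul_one] at h2
  rw [← map_form_X] at h2
  have h3 := congrArg (fun F => F I J) h2
  have h4 : formLog k = map₂ (Polynomial.evalRingHom a) (map₂ Polynomial.C (formLog k)) := by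
    ext; simp
  simp only [C_mul_apply] at h3 ⊢
  rw [h4, mul_comm (map₂ _ _), ← map_mul] at h3
  rw [Polynomial.eval_mul, Polynomial.eval_X]
  exact h3

/-- The polynomial ring is the universal case: the identity there holds because it holds at all real
points, and any `c` is a specialisation of the variable. -/
theorem ketD_form (k : ℕ) (c : K) : ketD k (form c) =
    C (C c) * (form c * map₂ (algebraMap ℝ K) (formLog k)) := by
  have h := congrArg (map₂ (Polynomial.eval₂RingHom (algebraMap ℝ K) c)) (ketD_form_poly k)
  have h1 := map_form (Polynomial.eval₂RingHom (algebraMap ℝ K) c) (by simp) Polynomial.X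
  rw [Polynomial.coe_eval₂RingHom, Polynomial.eval₂_X] at h1
  have h2 : ∀ F : Shuffle (Shuffle (Polynomial ℝ)),
    map₂ (Polynomial.eval₂RingHom (algebraMap ℝ K) c) (ketD k F) = ketD k (map₂ _ F) := fun _ => rfl
  have h3 : map₂ (Polynomial.eval₂RingHom (algebraMap ℝ K) c) (C (C Polynomial.X)) = C (C c) := by
    ext I J; rcases I with _ | _ <;> rcases J with _ | _ <;> simp
  have h4 : map₂ (Polynomial.eval₂RingHom (algebraMap ℝ K) c) (map₂ Polynomial.C (formLog k))
    = map₂ (algebraMap ℝ K) (formLog k) := by ext I J; simp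
  rw [h2, map_mul, map_mul, h1, h3, h4] at h
  exact h

end Form

/-! ### The three-point coefficients -/

/-- The three-point coefficients for `h̃ = 0` over a commutative ring. -/
def vertexAt (h : K) : List ℕ → K
  | [] => 1
  | k :: w => ((w.sum : K) + ((k : K) - 1) * h) * vertexAt h w

/-- The three-point coefficients of the words in the letters `L_{-k}` with `k ≥ 2`. -/
def vertexFun (h : K) : Shuffle K := pull (· + 2) (mk (vertexAt h))

theorem shift_vertexFun (h : K) (k : ℕ) : shift k (vertexFun h) =
    C (((k : K) + 1) * h) * vertexFun h + euler (vertexFun h) := by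
  ext w
  have : ((w.map (· + 2)).sum : ℕ) = wt w := rfl
  simp only [vertexFun, shift_apply, pull_apply, List.map_cons, vertexAt,
    Shuffle.add_apply, C_mul_apply, euler_apply, this]
  push_cast; ring

theorem eq_of_shift_eq {f g : Shuffle K} {a : ℕ → K} (h0 : f [] = g [])
    (hf : ∀ k, shift k f = C (a k) * f + euler f) (hg : ∀ k, shift k g = C (a k) * g + euler g) :
    f = g := by
  ext w
  induction w with
  | nil => exact h0
  | cons k w ih =>
    change shift k f w = shift k g w
    rw [hf, hg]; simp [ih]

/-- The three-point coefficients solve a first-order linear system whose inhomogeneity is the Euler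
derivation. The coefficients of the system are linear in `h`, so a product of solutions solves the
system for the sum of the weights. -/
theorem vertexFun_add (a b : K) : vertexFun (a + b) = vertexFun a * vertexFun b := by
  refine eq_of_shift_eq (by simp [mul_nil, vertexFun, vertexAt]) (shift_vertexFun _) fun k => ?_
  rw [shift_mul, shift_vertexFun, shift_vertexFun, Derivation.leibniz,
    mul_add ((k : K) + 1), map_add]
  simp only [smul_eq_mul]; ring

theorem vertexFun_zero : vertexFun (0 : K) = 1 := by
  refine eq_of_shift_eq rfl (shift_vertexFun _) fun k => ?_
  have : shift k (1 : Shuffle K) = 0 := rfl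
  rw [this, Derivation.map_one_eq_zero]; simp

theorem map_vertexAt (φ : K →+* K') (h : K) (w : List ℕ) : φ (vertexAt h w) = vertexAt (φ h) w := by
  induction w with
  | nil => simp [vertexAt]
  | cons k w ih => rw [vertexAt, vertexAt, map_mul, ih]; simp [-Nat.cast_list_sum]

/-- The three-point coefficients of non-increasing words. -/
def vertex (h : K) : Shuffle K := symm (vertexFun h)

theorem vertex_apply (h : K) (w : List ℕ) : vertex h w = vertexAt h ((sortWord w).map (· + 2)) := rfl

theorem isSymm_vertex (h : K) : IsSymm (vertex h) := isSymm_symm _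

theorem map_vertex (φ : K →+* K') (h : K) : Shuffle.map φ (vertex h) = vertex (φ h) := by
  ext w; exact map_vertexAt φ h _

theorem vertex_add (a b : K) : vertex (a + b) = vertex a * vertex b := by
  rw [vertex, vertexFun_add, map_mul]; rfl

theorem vertex_zero : vertex (0 : K) = 1 := by rw [vertex, vertexFun_zero, map_one]

/-- A family of derivations of shuffle algebras with real coefficients. -/
theorem exists_derivation_vertex (D : ∀ {R : Type} [CommRing R], Der (Shuffle R))
    (hD : ∀ {R S : Type} [CommRing R] [CommRing S] (φ : R →+* S) (f : Shuffle R),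
      D (Shuffle.map φ f) = Shuffle.map φ (D f)) :
    ∃ γ : Shuffle ℝ, ∀ {K : Type} [CommRing K] [Algebra ℝ K] (h : K),
      D (vertex h) = C h * (vertex h * Shuffle.map (algebraMap ℝ K) γ) := by
  have hinv : ∀ a : ℝ, vertex a * vertex (-a) = 1 := fun a => by
    rw [← vertex_add, add_neg_cancel, vertex_zero]
  have hadd : ∀ a b : ℝ, D (vertex (a + b)) * vertex (-(a + b))
      = D (vertex a) * vertex (-a) + D (vertex b) * vertex (-b) := by
    intro a b
    rw [vertex_add, neg_add, vertex_add, Der.leibniz]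
    linear_combination (D (vertex b) * vertex (-b)) * hinv a
      + (D (vertex a) * vertex (-a)) * hinv b
  -- The logarithmic derivative at `h = 1`. As for the form, additivity and polynomiality in `h`
  -- make it linear in `h`.
  let γ : Shuffle ℝ := D (vertex 1) * vertex (-1)
  have hreal : ∀ a : ℝ, D (vertex a) * vertex (-a) = C a * γ := by
    intro a
    ext w
    let P : Polynomial ℝ := (D (vertex Polynomial.X) * vertex (-Polynomial.X) : Shuffle _) w
    have hP : ∀ a : ℝ, P.eval a = (D (vertex a) * vertex (-a)) w := by
      intro a
      have h1 := map_vertex (Polynomial.evalRingHom a) Polynomial.X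
      have h2 := map_vertex (Polynomial.evalRingHom a) (-Polynomial.X)
      rw [map_neg, Polynomial.coe_evalRingHom, Polynomial.eval_X] at h2
      rw [Polynomial.coe_evalRingHom, Polynomial.eval_X] at h1
      rw [← h1, ← h2, hD, ← map_mul]
      rfl
    rw [← hP, eval_of_additive (fun a b => by rw [hP, hP, hP, hadd]; rfl), hP]
    simp [γ]
  refine ⟨γ, fun {K} _ _ h => ?_⟩
  have hpoly : D (vertex (Polynomial.X : Polynomial ℝ)) =
      C Polynomial.X * (vertex Polynomial.X * Shuffle.map Polynomial.C γ) := by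
    ext w : 1
    refine Polynomial.funext fun a => ?_
    have h1 := map_vertex (Polynomial.evalRingHom a) Polynomial.X
    rw [Polynomial.coe_evalRingHom, Polynomial.eval_X] at h1
    have h2 := congrArg (· * vertex a) (hreal a)
    simp only [mul_assoc, mul_comm (vertex (-a)), hinv, mul_one] at h2
    rw [← h1, hD] at h2
    have h3 := congrArg (fun F => F w) h2
    have h4 : γ = Shuffle.map (Polynomial.evalRingHom a) (Shuffle.map Polynomial.C γ) := by
      ext; simp
    simp only [C_mul_apply] at h3 ⊢
    rw [h4, mul_comm (Shuffle.map _ _), ← map_mul] at h3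
    rw [Polynomial.eval_mul, Polynomial.eval_X]
    exact h3
  have h0 := congrArg (Shuffle.map (Polynomial.eval₂RingHom (algebraMap ℝ K) h)) hpoly
  have h1 := map_vertex (Polynomial.eval₂RingHom (algebraMap ℝ K) h) Polynomial.X
  rw [Polynomial.coe_eval₂RingHom, Polynomial.eval₂_X] at h1
  have h3 : Shuffle.map (Polynomial.eval₂RingHom (algebraMap ℝ K) h) (C Polynomial.X) = C h := by
    ext w; rcases w with _ | _ <;> simp
  have h4 : Shuffle.map (Polynomial.eval₂RingHom (algebraMap ℝ K) h) (Shuffle.map Polynomial.C γ)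
    = Shuffle.map (algebraMap ℝ K) γ := by ext w; simp
  rw [← hD, map_mul, map_mul, h1, h3, h4] at h0
  exact h0

/-! ### Regularity of logarithmic derivatives of flows -/

section Flow

variable {R : Type*} [CommRing R]

/-- The derivation `z d/dz` of power series. -/
def theta : Der (PowerSeries R) :=
  derivationOf ⟨⟨fun f => PowerSeries.X * PowerSeries.derivative R f, by simp⟩,
    fun f g => by simp [mul_add]⟩ fun f g => by simp [Derivation.leibniz]; ring

theorem coeff_theta (n : ℕ) (f : PowerSeries R) :
    PowerSeries.coeff n (theta f) = n * PowerSeries.coeff n f := by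
  change PowerSeries.coeff n (PowerSeries.X * PowerSeries.derivative R f) = _
  cases n with
  | zero => simp
  | succ n => rw [PowerSeries.coeff_succ_X_mul, PowerSeries.coeff_derivative]; push_cast; ring

/-- A derivation of the coefficients, as a derivation of power series. -/
def coeffD (d : Der R) : Der (PowerSeries R) :=
  derivationOf ⟨⟨fun f => PowerSeries.mk fun n => d (PowerSeries.coeff n f), by ext; simp⟩,
    fun f g => by ext; simp⟩ fun f g => by
      ext n
      simp only [AddMonoidHom.coe_mk, ZeroHom.coe_mk, PowerSeries.coeff_mk, map_add,
        PowerSeries.coeff_mul, map_sum, Der.leibniz, Finset.sum_add_distrib]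
      rw [add_comm]
      congr 1
      exact Finset.sum_congr rfl fun _ _ => mul_comm _ _

@[simp] theorem coeff_coeffD (d : Der R) (n : ℕ) (f : PowerSeries R) :
    PowerSeries.coeff n (coeffD d f) = d (PowerSeries.coeff n f) := by
  change PowerSeries.coeff n (PowerSeries.mk fun n => d (PowerSeries.coeff n f)) = _
  simp

/-- Mixed derivatives of `log u` agree, stated without a logarithm. -/
theorem logDeriv_comm {S : Type*} [CommRing S] (d e : Der S) (hde : ∀ f, d (e f) = e (d f))
    {a u v : S} (hd : d a = 0) (he : e a = 0) (huv : u * v = 1) :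
    d (v * (a * e u)) = e (v * (a * d u)) := by
  have key : ∀ d : Der S, d v = -(v * v * d u) := fun d => by
    have h := congrArg d huv
    rw [Der.leibniz, Derivation.map_one_eq_zero] at h
    linear_combination v * h - d v * huv
  simp only [Der.leibniz, hd, he, key, hde]
  ring

/-- The composition of the operators `a D_k` along a word. -/
def opWord (a : R) (D : ℕ → Der R) (w : List ℕ) (f : R) : R :=
  w.foldr (fun k g => a * D k g) f

theorem opWord_cons (a : R) (D : ℕ → Der R) (k : ℕ) (w : List ℕ) (f : R) :
    opWord a D (k :: w) f = a * D k (opWord a D w f) := rfl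

/-- The WKB principle. The equation `a θ Θ = ∑ z ^ m T_m Θ` becomes, for the logarithm of `Θ`, a
Hamilton–Jacobi equation that involves only `a D_k log Θ` and its `a D`-derivatives, so no inverse
powers of `a` can appear if there are none at `z = 0`. -/
theorem regular_logDeriv (O : Subring R)
    (hdiv : ∀ (n : ℕ) (r : R), ((n + 1 : ℕ) : R) * r ∈ O → r ∈ O)
    (D : ℕ → Der R) (hD : ∀ k, ∀ r ∈ O, D k r ∈ O) {a : R} (ha : a ∈ O)
    (hDa : ∀ k, D k a = 0) {ι : ℕ → Type*} [∀ m, Fintype (ι m)] (word : ∀ m, ι m → List ℕ)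
    (σ : ∀ m, ι m → R) (hσ : ∀ m i, σ m i ∈ O) (N : ℕ) (Θ : PowerSeries R) (hu : IsUnit Θ)
    (h0 : ∀ k, ∃ r ∈ O, a * D k (PowerSeries.coeff 0 Θ) = PowerSeries.coeff 0 Θ * r)
    (hΘ : ∀ n : ℕ, (n : R) * (a * PowerSeries.coeff n Θ) = ∑ m ∈ Finset.range N,
      if m + 1 ≤ n then ∑ i : ι (m + 1), σ (m + 1) i *
        opWord a D (word (m + 1) i) (PowerSeries.coeff (n - (m + 1)) Θ) else 0) :
    ∃ q : PowerSeries R, PowerSeries.C a * theta Θ = Θ * q ∧ ∀ n, PowerSeries.coeff n q ∈ O := by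
  obtain ⟨V, hV⟩ := hu.exists_right_inv
  -- `r k` is `a D_k Θ / Θ`. Conjugation by `Θ` turns `a D_k` into `a D_k + r k`, and `U w` is the
  -- composite of these along `w`, applied to 1.
  let r : ℕ → PowerSeries R := fun k => V * (PowerSeries.C a * coeffD (D k) Θ)
  let U : List ℕ → PowerSeries R := fun w =>
    w.foldr (fun k g => PowerSeries.C a * coeffD (D k) g + r k * g) 1
  have hop : ∀ w n, opWord a D w (PowerSeries.coeff n Θ) = PowerSeries.coeff n (Θ * U w) := by
    intro w
    induction w with
    | nil => intro n; simp [opWord, U]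
    | cons k w ih =>
      intro n
      have e : PowerSeries.C a * coeffD (D k) (Θ * U w) = Θ * U (k :: w) := by
        have : U (k :: w) = PowerSeries.C a * coeffD (D k) (U w) + r k * U w := rfl
        rw [this, Der.leibniz]
        simp only [r]
        linear_combination -(PowerSeries.C a * coeffD (D k) Θ * U w) * hV
      rw [← e, opWord_cons, ih, PowerSeries.coeff_C_mul, coeff_coeffD]
  let q : PowerSeries R := ∑ m ∈ Finset.range N, PowerSeries.X ^ (m + 1) *
    ∑ i : ι (m + 1), PowerSeries.C (σ (m + 1) i) * U (word (m + 1) i)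
  have hq : PowerSeries.C a * theta Θ = Θ * q := by
    ext n
    rw [PowerSeries.coeff_C_mul, coeff_theta, mul_left_comm, hΘ]
    simp only [q]
    rw [Finset.mul_sum, map_sum]
    refine Finset.sum_congr rfl fun m _ => ?_
    rw [mul_left_comm, PowerSeries.coeff_X_pow_mul']
    split_ifs with h
    · rw [Finset.mul_sum, map_sum]
      refine Finset.sum_congr rfl fun i _ => ?_
      rw [hop, mul_left_comm, PowerSeries.coeff_C_mul]
    · rfl
  refine ⟨q, hq, ?_⟩
  -- Cross-differentiation closes the induction: `q` at level `n` needs `r` only below `n`, since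
  -- every operator carries a positive power of `z`, and level `n` of `r` is recovered from `q` by
  -- dividing by `n`.
  have hcomm : ∀ k, theta (r k) = coeffD (D k) q := by
    intro k
    have e : q = V * (PowerSeries.C a * theta Θ) := by
      rw [hq]; linear_combination (-q) * hV
    rw [e]
    refine logDeriv_comm theta (coeffD (D k)) (fun f => ?_) ?_ ?_ hV
    · ext n
      simp only [coeff_theta, coeff_coeffD, Der.leibniz,
        Derivation.map_natCast, mul_zero, add_zero]
    · ext n
      rw [coeff_theta, PowerSeries.coeff_C]
      split_ifs with h <;> simp [h]
    · ext n
      rw [coeff_coeffD, PowerSeries.coeff_C]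
      split_ifs <;> simp [hDa]
  have hU : ∀ n, (∀ j < n, ∀ k, PowerSeries.coeff j (r k) ∈ O) →
      ∀ w, ∀ j < n, PowerSeries.coeff j (U w) ∈ O := by
    intro n hr w
    induction w with
    | nil =>
      intro j _
      change PowerSeries.coeff j 1 ∈ O
      rw [PowerSeries.coeff_one]
      split_ifs
      · exact O.one_mem
      · exact O.zero_mem
    | cons k w ih =>
      intro j hj
      change PowerSeries.coeff j (PowerSeries.C a * coeffD (D k) (U w) + r k * U w) ∈ O
      rw [map_add, PowerSeries.coeff_C_mul, coeff_coeffD, PowerSeries.coeff_mul]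
      refine O.add_mem (O.mul_mem ha (hD k _ (ih j hj))) (O.sum_mem fun x hx => ?_)
      have h : x.1 + x.2 = j := by simpa using hx
      exact O.mul_mem (hr _ (by omega) k) (ih _ (by omega))
  have hqr : ∀ n, (∀ j < n, ∀ k, PowerSeries.coeff j (r k) ∈ O) → PowerSeries.coeff n q ∈ O := by
    intro n hr
    simp only [q]
    rw [map_sum]
    refine O.sum_mem fun m _ => ?_
    rw [PowerSeries.coeff_X_pow_mul']
    split_ifs with h
    · rw [map_sum]
      refine O.sum_mem fun i _ => ?_
      rw [PowerSeries.coeff_C_mul]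
      exact O.mul_mem (hσ _ _) (hU n hr _ _ (by omega))
    · exact O.zero_mem
  have hr : ∀ n, ∀ k, PowerSeries.coeff n (r k) ∈ O := by
    intro n
    induction n using Nat.strong_induction_on with
    | _ n ih =>
      intro k
      rcases n with _ | n
      · obtain ⟨s, hs, hs'⟩ := h0 k
        have h1 : PowerSeries.coeff 0 Θ * PowerSeries.coeff 0 V = 1 := by
          simpa using congrArg (PowerSeries.coeff 0) hV
        have : PowerSeries.coeff 0 (r k) = s := by
          simp only [r]
          rw [PowerSeries.coeff_mul, Finset.Nat.antidiagonal_zero, Finset.sum_singleton,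
            PowerSeries.coeff_C_mul, coeff_coeffD, hs']
          linear_combination s * h1
        rwa [this]
      · refine hdiv n _ ?_
        rw [← coeff_theta, hcomm, coeff_coeffD]
        exact hD k _ (hqr _ ih)
  exact fun n => hqr n fun j _ k => hr j k

end Flow

/-! ### Values in a subring, and vanishing orders in the word length -/

namespace Shuffle

variable {K : Type*} [CommRing K]

/-- The functions on words with values in a subring. -/
def valuesIn (O : Subring K) : Subring (Shuffle K) where
  carrier := {f | ∀ w, f w ∈ O}
  one_mem' := fun w => by
    cases w with
    | nil => exact O.one_mem
    | cons => exact O.zero_mem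
  zero_mem' := fun _ => O.zero_mem
  add_mem' := fun hf hg w => O.add_mem (hf w) (hg w)
  neg_mem' := fun hf w => O.neg_mem (hf w)
  mul_mem' := by
    intro f g hf hg w
    induction w generalizing f g with
    | nil => exact O.mul_mem (hf []) (hg [])
    | cons k w ih => exact O.add_mem (ih (fun u => hf (k :: u)) hg) (ih hf fun u => hg (k :: u))

theorem C_mem_valuesIn {O : Subring K} {a : K} (ha : a ∈ O) : C a ∈ valuesIn O := by
  intro w
  cases w with
  | nil => exact ha
  | cons => exact O.zero_mem

theorem mul_eq_zero_of_length {g : Shuffle K} {a : ℕ} (hg : ∀ u : List ℕ, u.length < a → g u = 0)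
    (f : Shuffle K) (w : List ℕ) (hw : w.length < a) : (f * g) w = 0 := by
  induction w generalizing f g a with
  | nil => rw [mul_nil, hg _ hw, mul_zero]
  | cons k w ih =>
    rw [List.length_cons] at hw
    rw [mul_cons, ih hg _ (by omega), zero_add]
    exact ih (a := a - 1) (fun u hu => hg (k :: u) (by rw [List.length_cons]; omega)) f (by omega)

/-- As `f` vanishes at the empty word, at least one letter must go to `f`, which leaves a shorter
word for `g`. -/
theorem mul_eq_zero_of_length_succ {f g : Shuffle K} {a : ℕ} (hf : f [] = 0)
    (hg : ∀ u : List ℕ, u.length < a → g u = 0) (w : List ℕ) (hw : w.length < a + 1) :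
    (f * g) w = 0 := by
  induction w generalizing g a with
  | nil => rw [mul_nil, hf, zero_mul]
  | cons k w ih =>
    rw [List.length_cons] at hw
    rw [mul_cons, mul_eq_zero_of_length hg _ w (by omega), zero_add]
    exact ih (a := a - 1) (fun u hu => hg (k :: u) (by rw [List.length_cons]; omega)) (by omega)

theorem mul_eq_of_length {g : Shuffle K} {a : ℕ} (hg : ∀ u : List ℕ, u.length < a → g u = 0)
    (f : Shuffle K) (w : List ℕ) (hw : w.length = a) : (f * g) w = f [] * g w := by
  induction w generalizing g a with
  | nil => rfl
  | cons k w ih =>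
    rw [List.length_cons] at hw
    rw [mul_cons, mul_eq_zero_of_length hg _ w (by omega), zero_add]
    exact ih (a := a - 1) (fun u hu => hg (k :: u) (by rw [List.length_cons]; omega)) (by omega)

theorem mul_cons_of_length {g : Shuffle K} {a : ℕ} (hg : ∀ u : List ℕ, u.length < a → g u = 0)
    (f : Shuffle K) (k : ℕ) (w : List ℕ) (hw : w.length = a) :
    (f * g) (k :: w) = f [k] * g w + (f * shift k g) w := by
  rw [mul_cons, mul_eq_of_length hg _ w hw]; rfl

theorem mul_nonneg_of_length {f g : Shuffle ℝ} {a : ℕ} (hf : f [] = 0) (hf' : ∀ k, 0 ≤ f [k])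
    (hg : ∀ u : List ℕ, u.length < a → g u = 0) (hg' : ∀ u : List ℕ, u.length = a → 0 ≤ g u)
    (w : List ℕ) (hw : w.length = a + 1) : 0 ≤ (f * g) w := by
  induction w generalizing g a with
  | nil => simp at hw
  | cons k w ih =>
    rw [List.length_cons] at hw
    rw [mul_cons_of_length hg _ _ _ (by omega)]
    refine add_nonneg (mul_nonneg (hf' k) (hg' _ (by omega))) ?_
    rcases w with _ | ⟨j, w⟩
    · rw [mul_nil, hf, zero_mul]
    · rw [List.length_cons] at hw
      refine ih (a := a - 1) (fun u hu => hg (k :: u) (by rw [List.length_cons]; omega))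
        (fun u hu => hg' (k :: u) (by rw [List.length_cons]; omega)) ?_
      rw [List.length_cons]; omega

theorem exists_perm_of_mul_ne_zero {f g : Shuffle K} {a : ℕ} (hf : f [] = 0)
    (hg : ∀ u : List ℕ, u.length < a → g u = 0) (w : List ℕ) (hw : w.length = a + 1)
    (h : (f * g) w ≠ 0) : ∃ k u, w.Perm (k :: u) ∧ f [k] ≠ 0 ∧ g u ≠ 0 := by
  induction w generalizing g a with
  | nil => simp at hw
  | cons k w ih =>
    rw [List.length_cons] at hw
    rw [mul_cons_of_length hg _ _ _ (by omega)] at h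
    by_cases h1 : f [k] * g w = 0
    · rw [h1, zero_add] at h
      have hw' : w.length = a - 1 + 1 := by
        rcases w with _ | ⟨j, w⟩
        · exact absurd (by rw [mul_nil, hf, zero_mul]) h
        · rw [List.length_cons] at hw ⊢; omega
      obtain ⟨j, u, hu, hj, hg'⟩ := ih (a := a - 1)
        (fun u hu => hg (k :: u) (by rw [List.length_cons]; omega)) hw' h
      exact ⟨j, k :: u, (hu.cons k).trans (List.Perm.swap j k u), hj, hg'⟩
    · exact ⟨k, w, List.Perm.refl _, left_ne_zero_of_mul h1, right_ne_zero_of_mul h1⟩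

end Shuffle

/-! ### Partitions without parts equal to one -/

/-- The partitions of `n` without parts equal to one. -/
abbrev Part (n : ℕ) := {p : Nat.Partition n // 1 ∉ p.parts}

/-- The word of a partition, in the letters `a` that stand for `L_{-(a + 2)}`. -/
def Part.word {n : ℕ} (p : Part n) : List ℕ := (wordOf p.1).map (· - 2)

theorem Part.two_le {n : ℕ} (p : Part n) {k : ℕ} (hk : k ∈ wordOf p.1) : 2 ≤ k := by
  have h : k ∈ p.1.parts := (Multiset.mem_sort _).1 hk
  have h1 := p.1.parts_pos h
  have h2 : k ≠ 1 := fun e => p.2 (e ▸ h)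
  omega

theorem Part.map_word {n : ℕ} (p : Part n) : p.word.map (· + 2) = wordOf p.1 := by
  rw [Part.word, List.map_map]
  refine (List.map_congr_left fun k hk => ?_).trans (List.map_id _)
  have := p.two_le hk
  simp only [Function.comp_apply, id]; omega

theorem Part.sortWord_word {n : ℕ} (p : Part n) : sortWord p.word = p.word := by
  refine sortWord_of_pairwise ?_
  rw [Part.word, List.pairwise_map]
  exact (Multiset.pairwise_sort _ _).imp fun h => by omega

theorem Part.wt_word {n : ℕ} (p : Part n) : wt p.word = n := by
  rw [wt, p.map_word, ← Multiset.sum_coe, wordOf, Multiset.sort_eq, p.1.parts_sum]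

theorem Part.eq_of_perm {n : ℕ} {p q : Part n} (h : p.word.Perm q.word) : p = q := by
  have h1 := h.map (· + 2)
  rw [p.map_word, q.map_word, ← Multiset.coe_eq_coe, wordOf, wordOf, Multiset.sort_eq,
    Multiset.sort_eq] at h1
  exact Subtype.ext (Nat.Partition.ext h1)

theorem exists_word_perm (w : List ℕ) : ∃ p : Part (wt w), w.Perm p.word := by
  refine ⟨⟨⟨(w.map (· + 2) : List ℕ), ?_, ?_⟩, ?_⟩, ?_⟩
  · intro i hi
    obtain ⟨a, -, rfl⟩ := List.mem_map.1 (Multiset.mem_coe.1 hi)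
    omega
  · rfl
  · intro hi
    obtain ⟨a, -, h⟩ := List.mem_map.1 (Multiset.mem_coe.1 hi)
    omega
  · have h : (wordOf (⟨(w.map (· + 2) : List ℕ), by
        intro i hi
        obtain ⟨a, -, rfl⟩ := List.mem_map.1 (Multiset.mem_coe.1 hi)
        omega, rfl⟩ : Nat.Partition (wt w))).Perm (w.map (· + 2)) := by
      rw [← Multiset.coe_eq_coe]; exact Multiset.sort_eq _ _
    have h2 := (h.map (· - 2)).symm
    rw [List.map_map] at h2
    refine List.Perm.trans (List.Perm.of_eq ?_) h2
    simp [Function.comp_def]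

theorem exists_word_perm_of_wt {n : ℕ} {w : List ℕ} (h : wt w = n) :
    ∃ p : Part n, w.Perm p.word := h ▸ exists_word_perm w

/-! ### The Gram matrix near infinite central charge -/

section Gram

/-- The symbol of the Shapovalov form: `c ^ (-r) ∂_{k₁} ⋯ ∂_{kᵣ}` applied to the form, divided by the
form, as a power series in `1 / c`. -/
def formSymbol : List ℕ → Shuffle (Shuffle (PowerSeries ℝ))
  | [] => 1
  | k :: w => C (C PowerSeries.X) * ketD k (formSymbol w)
      + map₂ PowerSeries.C (formLog k) * formSymbol w

variable {K : Type*} [CommRing K]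

theorem opWord_ketD (a : K) (w : List ℕ) (F : Shuffle (Shuffle K)) (I u : List ℕ) :
    opWord (C (C a)) ketD w F I u = a ^ w.length * F I (w.reverse ++ u) := by
  induction w generalizing u with
  | nil => simp [opWord]
  | cons k w ih =>
    rw [opWord_cons, C_mul_apply, C_mul_apply, ketD_apply, ih, List.length_cons, List.reverse_cons,
      List.append_assoc, pow_succ']
    simp [mul_assoc]

theorem opWord_shiftD (a : K) (w : List ℕ) (f : Shuffle K) (u : List ℕ) :
    opWord (C a) shiftD w f u = a ^ w.length * f (w.reverse ++ u) := by
  induction w generalizing u with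
  | nil => simp [opWord]
  | cons k w ih =>
    rw [opWord_cons, C_mul_apply, shiftD_apply, shift_apply, ih, List.length_cons,
      List.reverse_cons, List.append_assoc, pow_succ']
    simp [mul_assoc]

variable [Algebra ℝ K]

/-- The logarithmic derivative of the form is proportional to `c`, and the factor `1 / c` attached
to each derivation cancels it; what remains is regular in `1 / c`. Here `η` places the variable `1 /
c` in `K`. -/
theorem opWord_form (η : PowerSeries ℝ →+* K) (hη : ∀ r, η (PowerSeries.C r) = algebraMap ℝ K r)
    {c : K} (hc : η PowerSeries.X * c = 1) (w : List ℕ) :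
    opWord (C (C (η PowerSeries.X))) ketD w (form c) = form c * map₂ η (formSymbol w) := by
  induction w with
  | nil => simp [opWord, formSymbol]
  | cons k w ih =>
    have h1 : map₂ η (C (C PowerSeries.X)) = C (C (η PowerSeries.X)) := by
      ext I J; rcases I with _ | _ <;> rcases J with _ | _ <;> simp
    have h2 : map₂ η (map₂ PowerSeries.C (formLog k)) = map₂ (algebraMap ℝ K) (formLog k) := by
      ext I J; simp [hη]
    have h3 : map₂ η (ketD k (formSymbol w)) = ketD k (map₂ η (formSymbol w)) := rfl
    have h4 : (C (C (η PowerSeries.X)) * C (C c) : Shuffle (Shuffle K)) = 1 := by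
      rw [← map_mul, ← map_mul, hc, map_one, map_one]
    rw [opWord_cons, ih, Der.leibniz, ketD_form, formSymbol, map_add, map_mul, map_mul, h1, h2, h3]
    linear_combination (map₂ η (formSymbol w) * form c * map₂ (algebraMap ℝ K) (formLog k)) * h4

theorem form_nil_right (c : K) (I : List ℕ) : form c I [] = (1 : Shuffle K) I := by
  rcases I with _ | ⟨i, I⟩
  · rw [form_apply, sortWord_nil]; rfl
  · have h : sortWord (i :: I) ≠ [] := fun h => by
      have := (sortWord_perm (i :: I)); rw [h] at this; simpa using this.length_eq
    obtain ⟨a, b, h⟩ := List.exists_cons_of_ne_nil h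
    rw [form_apply, h, sortWord_nil]
    exact shap_nil_right _ _ _

theorem map_ev_form (c : K) : Shuffle.map ev (form c) = 1 := by
  ext I; exact form_nil_right c I

/-- The form with empty ket is the unit, so at the empty ket dividing by the form has no effect and
the symbol is a rescaled Gram entry. -/
theorem formSymbol_nil_right (η : PowerSeries ℝ →+* K)
    (hη : ∀ r, η (PowerSeries.C r) = algebraMap ℝ K r)
    {c : K} (hc : η PowerSeries.X * c = 1) (w I : List ℕ) :
    η (formSymbol w I []) = η PowerSeries.X ^ w.length * form c I w := by
  have h := congrArg (Shuffle.map ev) (opWord_form η hη hc w)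
  rw [map_mul, map_ev_form, one_mul] at h
  have h1 := congrArg (fun f : Shuffle K => f I) h
  simp only [Shuffle.map_apply, ev_apply] at h1
  rw [map₂_apply, opWord_ketD, List.append_nil] at h1
  rw [← h1, isSymm_form c I _ _ (List.reverse_perm w)]

/-- The classical limit of the logarithmic derivative of the form. -/
def classicalLog (k : ℕ) : Shuffle ℝ := Shuffle.map ev (formLog k)

/-- The classical limit of the Gram matrix. -/
def classicalForm : List ℕ → Shuffle ℝ
  | [] => 1
  | k :: w => classicalLog k * classicalForm w

/-- At `1 / c = 0` the derivative term in the symbol drops out and the symbol becomes a product of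
logarithmic derivatives. -/
theorem constantCoeff_formSymbol (w I : List ℕ) :
    PowerSeries.constantCoeff (formSymbol w I []) = classicalForm w I := by
  have h : Shuffle.map ev (map₂ PowerSeries.constantCoeff (formSymbol w)) = classicalForm w := by
    induction w with
    | nil => rw [formSymbol, map_one, map_one, classicalForm]
    | cons k w ih =>
      have h1 : map₂ (PowerSeries.constantCoeff (R := ℝ)) (C (C PowerSeries.X)) = 0 := by
        ext I J; rcases I with _ | _ <;> rcases J with _ | _ <;> simp
      have h2 : map₂ (PowerSeries.constantCoeff (R := ℝ)) (map₂ PowerSeries.C (formLog k))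
        = formLog k := by ext I J; simp
      rw [formSymbol, map_add, map_mul, map_mul, h1, h2, zero_mul, zero_add, map_mul, ih]
      rfl
  rw [← h]; rfl

theorem classicalLog_apply (k : ℕ) (I : List ℕ) : classicalLog k I = form (1 : ℝ) I [k] := by
  rw [classicalLog, formLog, map_mul, map_ev_form, mul_one]; rfl

theorem classicalLog_nil (k : ℕ) : classicalLog k [] = 0 := by
  rw [classicalLog_apply, form_apply]
  simp [sortWord, shap]

theorem classicalLog_singleton (k i : ℕ) :
    classicalLog k [i] = if i = k then (1 / 12) * (((k : ℝ) + 2) ^ 3 - (k + 2)) else 0 := by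
  rw [classicalLog_apply, form_apply]
  simp only [sortWord, Multiset.coe_singleton, Multiset.sort_singleton, List.map_cons, List.map_nil]
  rw [shap_singleton _ (by omega)]
  by_cases h : i = k
  · subst h; simp
  · simp [h]

theorem classicalLog_singleton_pos (k : ℕ) : 0 < classicalLog k [k] := by
  rw [classicalLog_singleton, if_pos rfl]
  have : (0 : ℝ) ≤ k := Nat.cast_nonneg k
  nlinarith [mul_nonneg this this, mul_nonneg (mul_nonneg this this) this]

theorem classicalLog_singleton_nonneg (k i : ℕ) : 0 ≤ classicalLog k [i] := by
  by_cases h : i = k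
  · subst h; exact (classicalLog_singleton_pos _).le
  · rw [classicalLog_singleton, if_neg h]

/-- Each factor vanishes at the empty word, so each needs a letter of its own. This is the
triangularity in word length of the Gram matrix at large `c`. -/
theorem classicalForm_eq_zero (w I : List ℕ) (h : I.length < w.length) : classicalForm w I = 0 := by
  induction w generalizing I with
  | nil => simp at h
  | cons k w ih => exact mul_eq_zero_of_length_succ (classicalLog_nil k) ih I h

theorem classicalForm_nonneg (w I : List ℕ) (h : I.length = w.length) : 0 ≤ classicalForm w I := by
  induction w generalizing I with
  | nil => rw [List.length_eq_zero_iff.1 h]; exact zero_le_one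
  | cons k w ih =>
    exact mul_nonneg_of_length (classicalLog_nil k) (classicalLog_singleton_nonneg k)
      (classicalForm_eq_zero w) ih I h

theorem classicalForm_self_pos (w : List ℕ) : 0 < classicalForm w w := by
  induction w with
  | nil => exact zero_lt_one
  | cons k w ih =>
    rw [classicalForm, mul_cons_of_length (classicalForm_eq_zero w) _ _ _ rfl]
    refine add_pos_of_pos_of_nonneg (mul_pos (classicalLog_singleton_pos k) ih) ?_
    rcases w with _ | ⟨j, w⟩
    · rw [mul_nil, classicalLog_nil, zero_mul]
    · refine mul_nonneg_of_length (a := w.length) (classicalLog_nil k)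
        (classicalLog_singleton_nonneg k) (fun u hu => ?_) (fun u hu => ?_) _ rfl
      · exact classicalForm_eq_zero (j :: w) (k :: u) (by rw [List.length_cons, List.length_cons]; omega)
      · exact classicalForm_nonneg (j :: w) (k :: u) (by rw [List.length_cons, List.length_cons, hu])

theorem perm_of_classicalForm_ne_zero (w I : List ℕ) (h : I.length = w.length)
    (h' : classicalForm w I ≠ 0) : I.Perm w := by
  induction w generalizing I with
  | nil => rw [List.length_eq_zero_iff.1 h]
  | cons k w ih =>
    obtain ⟨j, u, hu, hj, hw⟩ := exists_perm_of_mul_ne_zero (classicalLog_nil k)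
      (classicalForm_eq_zero w) I h h'
    rw [classicalLog_singleton, ite_ne_right_iff] at hj
    obtain ⟨rfl, -⟩ := hj
    refine hu.trans (List.Perm.cons _ (ih u ?_ hw))
    have := hu.length_eq
    simp only [List.length_cons] at this h
    omega

/-- The Gram matrix with columns rescaled by `c ^ (-r)`, as a matrix over power series in `1 / c`. -/
def gramSeries (n : ℕ) : Matrix (Part n) (Part n) (PowerSeries ℝ) :=
  Matrix.of fun p q => formSymbol q.word p.word []

theorem constantCoeff_gramSeries {n : ℕ} (p q : Part n) :
    PowerSeries.constantCoeff (gramSeries n p q) = classicalForm q.word p.word :=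
  constantCoeff_formSymbol _ _

theorem isUnit_det_gramSeries (n : ℕ) : IsUnit (gramSeries n).det := by
  rw [PowerSeries.isUnit_iff_constantCoeff, RingHom.map_det, isUnit_iff_ne_zero]
  intro h
  obtain ⟨v, hv, hv'⟩ := Matrix.exists_mulVec_eq_zero_iff.2 h
  obtain ⟨p₀, hp₀⟩ := Function.ne_iff.1 hv
  -- Shortest word in the support of a kernel vector: in its row longer words drop out by
  -- triangularity, and words of equal length contribute only if they are permutations of it,
  -- leaving a positive diagonal entry.
  obtain ⟨p, hp, hmin⟩ := Finset.exists_min_image (Finset.univ.filter fun p => v p ≠ 0)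
    (fun p => p.word.length) ⟨p₀, by simpa using hp₀⟩
  simp only [Finset.mem_filter, Finset.mem_univ, true_and] at hp hmin
  have h1 := congrFun hv' p
  simp only [Matrix.mulVec, dotProduct, RingHom.mapMatrix_apply, Matrix.map_apply, Pi.zero_apply] at h1
  rw [Finset.sum_eq_single p] at h1
  · rw [constantCoeff_gramSeries] at h1
    exact mul_ne_zero (classicalForm_self_pos _).ne' hp h1
  · intro q _ hq
    rw [constantCoeff_gramSeries]
    by_cases hvq : v q = 0
    · rw [hvq, mul_zero]
    · have h2 := hmin q hvq
      rcases h2.lt_or_eq with h3 | h3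
      · rw [classicalForm_eq_zero _ _ h3, zero_mul]
      · by_contra h4
        exact hq (Part.eq_of_perm
          (perm_of_classicalForm_ne_zero _ _ h3 (left_ne_zero_of_mul h4)).symm)
  · intro h; exact absurd (Finset.mem_univ _) h

end Gram

/-! ### Flows -/

section Flow

variable {K : Type} [CommRing K] [Algebra ℝ K]

/-- The solution of `a (z d/dz) Θ = ∑ z ^ m T_m Θ` with `Θ = Ψ` at `z = 0`, where `T_m`, `1 ≤ m ≤ N`,
is the differential operator `∑ σ_m(p) (a D)^p`, and `c a = 1`. -/
def flow {R : Type*} [CommRing R] (ι : K →+* R) (a c : K) (D : ℕ → Der R) (σ : ∀ m, Part m → K)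
    (N : ℕ) (Ψ : R) (n : ℕ) : R :=
  if n = 0 then Ψ else ι (algebraMap ℝ K (n : ℝ)⁻¹ * c) * ∑ m ∈ Finset.range N,
    if _h : m + 1 ≤ n then ∑ p : Part (m + 1), ι (σ (m + 1) p) *
      opWord (ι a) D p.word (flow ι a c D σ N Ψ (n - (m + 1))) else 0
termination_by n
decreasing_by omega

section

variable {R : Type*} [CommRing R] (ι : K →+* R) {a c : K} (D : ℕ → Der R)

theorem flow_zero (a c : K) (σ : ∀ m, Part m → K) (N : ℕ) (Ψ : R) :
    flow ι a c D σ N Ψ 0 = Ψ := by rw [flow, if_pos rfl]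

theorem flow_of_ne_zero (a c : K) (σ : ∀ m, Part m → K) (N : ℕ) (Ψ : R) {n : ℕ} (hn : n ≠ 0) :
    flow ι a c D σ N Ψ n = ι (algebraMap ℝ K (n : ℝ)⁻¹ * c) * ∑ m ∈ Finset.range N,
      if m + 1 ≤ n then ∑ p : Part (m + 1), ι (σ (m + 1) p) *
        opWord (ι a) D p.word (flow ι a c D σ N Ψ (n - (m + 1))) else 0 := by
  rw [flow, if_neg hn]
  simp only [dite_eq_ite]

theorem natCast_mul_flow (hac : a * c = 1) (σ : ∀ m, Part m → K) (N : ℕ) (Ψ : R) (n : ℕ) :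
    (n : R) * (ι a * flow ι a c D σ N Ψ n) = ∑ m ∈ Finset.range N,
      if m + 1 ≤ n then ∑ p : Part (m + 1), ι (σ (m + 1) p) *
        opWord (ι a) D p.word (flow ι a c D σ N Ψ (n - (m + 1))) else 0 := by
  rcases Nat.eq_zero_or_pos n with rfl | hn
  · simp
  · rw [flow_of_ne_zero _ _ _ _ _ _ _ hn.ne', ← mul_assoc, ← mul_assoc, ← map_natCast ι n, ← map_mul,
      ← map_mul]
    have h : (n : K) * a * (algebraMap ℝ K (n : ℝ)⁻¹ * c) = 1 := by
      have : algebraMap ℝ K (n : ℝ)⁻¹ * (n : K) = 1 := by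
        rw [← map_natCast (algebraMap ℝ K) n, ← map_mul, inv_mul_cancel₀ (by positivity), map_one]
      linear_combination hac + a * c * this
    rw [h, map_one, one_mul]

/-- Causality: level `n` sees only the symbols of order at most `n`, so symbols can be chosen
successively. -/
theorem flow_congr {σ σ' : ∀ m, Part m → K} {N N' : ℕ} (hN : N ≤ N') (h : ∀ m ≤ N, σ m = σ' m)
    (Ψ : R) {n : ℕ} (hn : n ≤ N) : flow ι a c D σ N Ψ n = flow ι a c D σ' N' Ψ n := by
  induction n using Nat.strong_induction_on with
  | _ n ih =>
    rcases Nat.eq_zero_or_pos n with rfl | hn'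
    · rw [flow_zero, flow_zero]
    · rw [flow_of_ne_zero _ _ _ _ _ _ _ hn'.ne', flow_of_ne_zero _ _ _ _ _ _ _ hn'.ne']
      congr 1
      rw [← Finset.sum_subset (Finset.range_mono hN) (fun m _ hm => ?_)]
      · refine Finset.sum_congr rfl fun m _ => ?_
        split_ifs with hm
        · rw [h _ (by omega), ih _ (by omega) (by omega)]
        · rfl
      · rw [Finset.mem_range] at hm
        rw [if_neg (by omega)]

end

/-- The flow acts in the ket alone and its symbols are constants, so the bra may be frozen. -/
theorem flow_apply {a c : K} (σ : ∀ m, Part m → K) (N : ℕ) (F : Shuffle (Shuffle K)) (n : ℕ)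
    (I : List ℕ) : flow ((C : Shuffle K →+* _).comp C) a c ketD σ N F n I
      = flow C a c shiftD σ N (F I) n := by
  have hop : ∀ (w : List ℕ) (F : Shuffle (Shuffle K)),
      opWord (((C : Shuffle K →+* _).comp C) a) ketD w F I = opWord (C a) shiftD w (F I) := by
    intro w F
    induction w with
    | nil => rfl
    | cons k w ih =>
      rw [opWord_cons, opWord_cons, ← ih, RingHom.comp_apply, C_mul_apply]; rfl
  induction n using Nat.strong_induction_on with
  | _ n ih =>
    rcases Nat.eq_zero_or_pos n with rfl | hn
    · rw [flow_zero, flow_zero]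
    · rw [flow_of_ne_zero _ _ _ _ _ _ _ hn.ne', flow_of_ne_zero _ _ _ _ _ _ _ hn.ne',
        RingHom.comp_apply, C_mul_apply, Shuffle.sum_apply]
      congr 1
      refine Finset.sum_congr rfl fun m _ => ?_
      split_ifs with hm
      · rw [Shuffle.sum_apply]
        refine Finset.sum_congr rfl fun p _ => ?_
        rw [RingHom.comp_apply, C_mul_apply, ← ih _ (by omega), ← hop, RingHom.comp_apply]
      · rfl

/-- The coefficients of a flow at symmetric functions are linear combinations of translates along the
words of partitions. -/
theorem exists_flow_eq_sum (a c : K) (σ : ∀ m, Part m → K) (N n : ℕ) :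
    ∃ x : Part n → K, ∀ f : Shuffle K, IsSymm f →
      flow C a c shiftD σ N f n [] = ∑ p, x p * f p.word := by
  -- Working with all symmetric functions at once makes the coefficients independent of the
  -- function; the extra word absorbs the letters that later operators prepend.
  let V := {f : Shuffle K // IsSymm f} × List ℕ → K
  let g : ∀ n, Part n → V := fun n p v => v.1.1 (p.word ++ v.2)
  let S : ∀ n, Submodule K V := fun n => Submodule.span K (Set.range (g n))
  have hS : ∀ m n (p : Part m) (Φ : V), Φ ∈ S n →
      (fun v => Φ (v.1, p.word.reverse ++ v.2)) ∈ S (n + m) := by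
    intro m n p Φ hΦ
    induction hΦ using Submodule.span_induction with
    | mem Φ h =>
      obtain ⟨r, rfl⟩ := h
      obtain ⟨s, hs⟩ := exists_word_perm_of_wt (n := n + m) (w := r.word ++ p.word)
        (by rw [wt_append, r.wt_word, p.wt_word])
      have : (fun v : {f : Shuffle K // IsSymm f} × List ℕ =>
          g n r (v.1, p.word.reverse ++ v.2)) = g (n + m) s := by
        funext v
        refine v.1.2 _ _ ?_
        change (r.word ++ (p.word.reverse ++ v.2)).Perm (s.word ++ v.2)
        rw [← List.append_assoc]
        exact (((List.reverse_perm p.word).append_left r.word).trans hs).append_right v.2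
      rw [this]
      exact Submodule.subset_span ⟨s, rfl⟩
    | zero => exact Submodule.zero_mem _
    | add Φ Φ' _ _ h h' => exact Submodule.add_mem _ h h'
    | smul r Φ _ h => exact Submodule.smul_mem _ r h
  have key : (fun v => flow C a c shiftD σ N v.1.1 n v.2 : V) ∈ S n := by
    induction n using Nat.strong_induction_on with
    | _ n ih =>
      rcases Nat.eq_zero_or_pos n with rfl | hn
      · obtain ⟨s, hs⟩ := exists_word_perm_of_wt (n := 0) (w := []) rfl
        refine Submodule.subset_span ⟨s, ?_⟩
        funext v
        rw [flow_zero]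
        change v.1.1 (s.word ++ v.2) = _
        rw [List.nil_perm.1 hs, List.nil_append]
      · have e : (fun v => flow C a c shiftD σ N v.1.1 n v.2 : V) =
            (algebraMap ℝ K (n : ℝ)⁻¹ * c) • ∑ m ∈ Finset.range N, if m + 1 ≤ n then
              ∑ p : Part (m + 1), (σ (m + 1) p * a ^ p.word.length) • (fun v =>
                flow C a c shiftD σ N v.1.1 (n - (m + 1)) (p.word.reverse ++ v.2) : V) else 0 := by
          funext v
          rw [flow_of_ne_zero _ _ _ _ _ _ _ hn.ne', C_mul_apply, Shuffle.sum_apply, Pi.smul_apply,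
            smul_eq_mul, Finset.sum_apply]
          congr 1
          refine Finset.sum_congr rfl fun m _ => ?_
          split_ifs with hm
          · rw [Shuffle.sum_apply, Finset.sum_apply]
            refine Finset.sum_congr rfl fun p _ => ?_
            rw [C_mul_apply, opWord_shiftD, Pi.smul_apply, smul_eq_mul, mul_assoc]
          · rfl
        rw [e]
        refine Submodule.smul_mem _ _ (Submodule.sum_mem _ fun m _ => ?_)
        split_ifs with hm
        · refine Submodule.sum_mem _ fun p _ => Submodule.smul_mem _ _ ?_
          have h := hS (m + 1) (n - (m + 1)) p _ (ih (n - (m + 1)) (by omega))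
          rwa [Nat.sub_add_cancel hm] at h
        · exact Submodule.zero_mem _
  obtain ⟨x, hx⟩ := (Submodule.mem_span_range_iff_exists_fun K).1 key
  refine ⟨x, fun f hf => ?_⟩
  have h := congrFun hx (⟨f, hf⟩, [])
  rw [← h, Finset.sum_apply]
  refine Finset.sum_congr rfl fun p _ => ?_
  change x p * f (p.word ++ []) = _
  rw [List.append_nil]

end Flow

/-! ### The grading by the weight -/

namespace Shuffle

variable {K : Type*} [CommRing K]

/-- The homogeneous components of a function on words, as a power series. -/
def grade (f : Shuffle K) : PowerSeries (Shuffle K) :=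
  PowerSeries.mk fun n => mk fun w => if wt w = n then f w else 0

theorem coeff_grade (f : Shuffle K) (n : ℕ) (w : List ℕ) :
    PowerSeries.coeff n (grade f) w = if wt w = n then f w else 0 := by
  rw [grade, PowerSeries.coeff_mk]

theorem mul_monomial_apply (f g : Shuffle K) (w : List ℕ) :
    ((mk fun u => PowerSeries.monomial (wt u) (f u)) *
      mk fun u => PowerSeries.monomial (wt u) (g u)) w = PowerSeries.monomial (wt w) ((f * g) w) := by
  have e : ∀ (f : Shuffle K) k, shift k (mk fun u => PowerSeries.monomial (wt u) (f u)) =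
      C (PowerSeries.monomial (k + 2) 1) * mk fun u => PowerSeries.monomial (wt u) (shift k f u) := by
    intro f k
    ext1 u
    rw [C_mul_apply, mk_apply, PowerSeries.monomial_mul_monomial, one_mul]; rfl
  induction w generalizing f g with
  | nil => simp [mul_nil]
  | cons k w ih =>
    rw [mul_cons, mul_cons, e, e, mul_left_comm, mul_assoc, C_mul_apply, C_mul_apply, ih, ih,
      PowerSeries.monomial_mul_monomial, PowerSeries.monomial_mul_monomial, one_mul, one_mul, map_add]
    rfl

theorem coeff_mul_apply (F G : Shuffle (PowerSeries K)) (n : ℕ) (w : List ℕ) :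
    PowerSeries.coeff n ((F * G) w) = ∑ ij ∈ Finset.HasAntidiagonal.antidiagonal n,
      ((mk fun u => PowerSeries.coeff ij.1 (F u)) * mk fun u => PowerSeries.coeff ij.2 (G u)) w := by
  induction w generalizing F G with
  | nil => exact PowerSeries.coeff_mul _ _ _
  | cons k w ih =>
    rw [mul_cons, map_add, ih, ih, ← Finset.sum_add_distrib]
    rfl

/-- The weight of a word is the sum of the weights of complementary subwords, so the components
multiply as power series. -/
theorem grade_mul (f g : Shuffle K) : grade (f * g) = grade f * grade g := by
  ext n w
  rw [coeff_grade, PowerSeries.coeff_mul, Shuffle.sum_apply]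
  have h := coeff_mul_apply (mk fun u => PowerSeries.monomial (wt u) (f u))
    (mk fun u => PowerSeries.monomial (wt u) (g u)) n w
  rw [mul_monomial_apply, PowerSeries.coeff_monomial] at h
  simp only [eq_comm (a := wt w), h]
  refine Finset.sum_congr rfl fun ij _ => ?_
  congr 2
  · ext u; simp [coeff_grade, PowerSeries.coeff_monomial, eq_comm]
  · ext u; simp [coeff_grade, PowerSeries.coeff_monomial, eq_comm]

theorem theta_grade (f : Shuffle K) : theta (grade f) = grade (euler f) := by
  ext n w
  rw [coeff_theta, natCast_mul_apply, coeff_grade, coeff_grade]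
  split_ifs with h
  · rw [euler_apply, h]
  · rw [mul_zero]

theorem C_mul_grade (a : K) (f : Shuffle K) : PowerSeries.C (C a) * grade f = grade (C a * f) := by
  ext n w
  rw [PowerSeries.coeff_C_mul, C_mul_apply, coeff_grade, coeff_grade]
  split_ifs <;> simp

end Shuffle

/-- The first discrepancy between two series appears in their logarithmic derivatives to first order
only. -/
theorem coeff_logDeriv_sub {S : Type*} [CommRing S] {x : S} {f g p q : PowerSeries S}
    (hf0 : PowerSeries.coeff 0 f = 1) (hg0 : PowerSeries.coeff 0 g = 1)
    (hf : PowerSeries.C x * theta f = f * p) (hg : PowerSeries.C x * theta g = g * q) (n : ℕ)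
    (h : ∀ j < n, PowerSeries.coeff j f = PowerSeries.coeff j g) :
    (n : S) * (x * (PowerSeries.coeff n g - PowerSeries.coeff n f))
      = PowerSeries.coeff n q - PowerSeries.coeff n p := by
  have hz : ∀ {f p : PowerSeries S}, PowerSeries.coeff 0 f = 1 →
      PowerSeries.C x * theta f = f * p → PowerSeries.coeff 0 p = 0 := by
    intro f p hf0 hf
    have := congrArg (PowerSeries.coeff 0) hf
    rw [PowerSeries.coeff_C_mul, coeff_theta, PowerSeries.coeff_mul, Finset.Nat.antidiagonal_zero,
      Finset.sum_singleton, hf0] at this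
    simpa using this.symm
  induction n using Nat.strong_induction_on with
  | _ n ih =>
    rcases n with _ | n
    · rw [hz hf0 hf, hz hg0 hg]; simp
    · have hpq : ∀ j ≤ n, PowerSeries.coeff j p = PowerSeries.coeff j q := by
        intro j hj
        have := ih j (by omega) fun i hi => h i (by omega)
        rw [h j (by omega), sub_self, mul_zero, mul_zero] at this
        exact (sub_eq_zero.1 this.symm).symm
      have e1 := congrArg (PowerSeries.coeff (n + 1)) hf
      have e2 := congrArg (PowerSeries.coeff (n + 1)) hg
      rw [PowerSeries.coeff_C_mul, coeff_theta, PowerSeries.coeff_mul,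
        Finset.Nat.sum_antidiagonal_succ, hf0] at e1
      rw [PowerSeries.coeff_C_mul, coeff_theta, PowerSeries.coeff_mul,
        Finset.Nat.sum_antidiagonal_succ, hg0] at e2
      have e3 : ∑ ij ∈ Finset.HasAntidiagonal.antidiagonal n, PowerSeries.coeff (ij.1 + 1) f * PowerSeries.coeff ij.2 p
          = ∑ ij ∈ Finset.HasAntidiagonal.antidiagonal n,
            PowerSeries.coeff (ij.1 + 1) g * PowerSeries.coeff ij.2 q := by
        refine Finset.sum_congr rfl fun ij hij => ?_
        have hij' : ij.1 + ij.2 = n := by simpa using hij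
        rcases Nat.eq_zero_or_pos ij.2 with h0 | h0
        -- The top coefficients, which may differ, meet only the constant term of the logarithmic
        -- derivative, and that vanishes.
        · rw [h0, hz hf0 hf, hz hg0 hg, mul_zero, mul_zero]
        · rw [hpq _ (by omega), h _ (by omega)]
      linear_combination e2 - e1 - e3

/-! ### The logarithm of the block at large central charge -/

section Existence

variable {K : Type} [CommRing K] [Algebra ℝ K]

theorem flow_logDeriv {R : Type*} [CommRing R] (ι : K →+* R) (D : ℕ → Der R) (O : Subring R)
    (hdiv : ∀ (n : ℕ) (r : R), ((n + 1 : ℕ) : R) * r ∈ O → r ∈ O)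
    (hD : ∀ k, ∀ r ∈ O, D k r ∈ O) {a c : K} (hac : a * c = 1) (ha : ι a ∈ O)
    (hDa : ∀ k, D k (ι a) = 0) (σ : ∀ m, Part m → K) (hσ : ∀ m p, ι (σ m p) ∈ O) (N : ℕ) (Ψ : R)
    (hu : IsUnit Ψ) (h0 : ∀ k, ∃ r ∈ O, ι a * D k Ψ = Ψ * r) :
    ∃ q : PowerSeries R, PowerSeries.C (ι a) * theta (PowerSeries.mk (flow ι a c D σ N Ψ))
      = PowerSeries.mk (flow ι a c D σ N Ψ) * q ∧ ∀ n, PowerSeries.coeff n q ∈ O := by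
  refine regular_logDeriv O hdiv D hD ha hDa (fun _ p => p.word) (fun m p => ι (σ m p)) hσ N _ ?_ ?_ ?_
  · rw [PowerSeries.isUnit_iff_constantCoeff, ← PowerSeries.coeff_zero_eq_constantCoeff_apply,
      PowerSeries.coeff_mk, flow_zero]
    exact hu
  · simpa only [PowerSeries.coeff_mk, flow_zero] using h0
  · intro n
    simp only [PowerSeries.coeff_mk]
    exact natCast_mul_flow ι D hac σ N Ψ n

variable {O : Subring K} {η : PowerSeries ℝ →+* K} {c h : K}

theorem map_theta {R S : Type*} [CommRing R] [CommRing S] (φ : R →+* S) (f : PowerSeries R) :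
    PowerSeries.map φ (theta f) = theta (PowerSeries.map φ f) := by
  ext n; simp [coeff_theta]

theorem mem_of_natCast_mul_mem (hη : ∀ r, η (PowerSeries.C r) = algebraMap ℝ K r)
    (hO : ∀ s, η s ∈ O) (n : ℕ) (r : K) (hr : ((n + 1 : ℕ) : K) * r ∈ O) : r ∈ O := by
  have h1 : algebraMap ℝ K ((n + 1 : ℕ) : ℝ)⁻¹ * ((n + 1 : ℕ) : K) = 1 := by
    rw [← map_natCast (algebraMap ℝ K), ← map_mul, inv_mul_cancel₀ (by positivity), map_one]
  have h2 : r = algebraMap ℝ K ((n + 1 : ℕ) : ℝ)⁻¹ * (((n + 1 : ℕ) : K) * r) := by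
    rw [← mul_assoc, h1, one_mul]
  rw [h2, ← hη]
  exact O.mul_mem (hO _) hr

/-- The WKB principle is applied with functions of bra and ket; evaluation at the empty ket is a
ring homomorphism and carries the conclusion to functions of the bra. -/
theorem flow_form_logDeriv (hη : ∀ r, η (PowerSeries.C r) = algebraMap ℝ K r)
    (hO : ∀ s, η s ∈ O) (hc : η PowerSeries.X * c = 1) (σ : ∀ m, Part m → K)
    (hσ : ∀ m p, σ m p ∈ O) (N : ℕ) :
    ∃ q : PowerSeries (Shuffle K),
      PowerSeries.C (C (η PowerSeries.X)) * theta (PowerSeries.mk fun n =>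
        (mk fun I => flow C (η PowerSeries.X) c shiftD σ N (form c I) n [] : Shuffle K))
      = (PowerSeries.mk fun n => mk fun I => flow C (η PowerSeries.X) c shiftD σ N (form c I) n []) * q
      ∧ ∀ n w, PowerSeries.coeff n q w ∈ O := by
  obtain ⟨q, hq, hq'⟩ := flow_logDeriv ((C : Shuffle K →+* _).comp C) ketD (valuesIn (valuesIn O))
    (fun n r hr I J => mem_of_natCast_mul_mem hη hO n _ (by
      have h := hr I J
      rwa [natCast_mul_apply, natCast_mul_apply] at h))
    (fun k r hr I J => hr I (k :: J)) hc (C_mem_valuesIn (C_mem_valuesIn (hO _)))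
    (fun k => by ext I J; rcases I with _ | _ <;> rcases J with _ | _ <;> simp)
    σ (fun m p => C_mem_valuesIn (C_mem_valuesIn (hσ m p))) N (form c)
    (IsUnit.of_mul_eq_one (form (-c)) (by rw [← form_add, add_neg_cancel, form_zero]))
    (fun k => ⟨map₂ (algebraMap ℝ K) (formLog k), fun I J => by
        rw [map₂_apply, ← hη]; exact hO _, by
      have h4 : (C (C (η PowerSeries.X)) * C (C c) : Shuffle (Shuffle K)) = 1 := by
        rw [← map_mul, ← map_mul, hc, map_one, map_one]
      rw [ketD_form, RingHom.comp_apply]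
      linear_combination (form c * map₂ (algebraMap ℝ K) (formLog k)) * h4⟩)
  refine ⟨PowerSeries.map (Shuffle.map ev) q, ?_, fun n w => ?_⟩
  · have h := congrArg (PowerSeries.map (Shuffle.map ev)) hq
    rw [map_mul, map_mul, map_theta, PowerSeries.map_C] at h
    have e1 : Shuffle.map ev (((C : Shuffle K →+* _).comp C) (η PowerSeries.X))
        = C (η PowerSeries.X) := by ext I; rcases I with _ | _ <;> simp
    have e2 : PowerSeries.map (Shuffle.map ev) (PowerSeries.mk
        (flow ((C : Shuffle K →+* _).comp C) (η PowerSeries.X) c ketD σ N (form c)))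
        = PowerSeries.mk fun n =>
          (mk fun I => flow C (η PowerSeries.X) c shiftD σ N (form c I) n [] : Shuffle K) := by
      ext n I
      rw [PowerSeries.coeff_map, PowerSeries.coeff_mk, PowerSeries.coeff_mk, Shuffle.map_apply,
        flow_apply, ev_apply]
    rwa [e1, e2] at h
  · rw [PowerSeries.coeff_map]
    exact hq' n w []

/-- The same principle with the three-point coefficients as initial value: their logarithmic
derivatives are linear in `h`, and `h / c` is regular. -/
theorem flow_vertex_logDeriv (hη : ∀ r, η (PowerSeries.C r) = algebraMap ℝ K r)
    (hO : ∀ s, η s ∈ O) (hc : η PowerSeries.X * c = 1) (hh : η PowerSeries.X * h ∈ O)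
    (σ : ∀ m, Part m → K) (hσ : ∀ m p, σ m p ∈ O) (N : ℕ) :
    ∃ q : PowerSeries K,
      PowerSeries.C (η PowerSeries.X) * theta (PowerSeries.mk fun n =>
        flow C (η PowerSeries.X) c shiftD σ N (vertex h) n [])
      = (PowerSeries.mk fun n => flow C (η PowerSeries.X) c shiftD σ N (vertex h) n []) * q
      ∧ ∀ n, PowerSeries.coeff n q ∈ O := by
  obtain ⟨q, hq, hq'⟩ := flow_logDeriv C shiftD (valuesIn O)
    (fun n r hr I => mem_of_natCast_mul_mem hη hO n _ (by
      have h := hr I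
      rwa [natCast_mul_apply] at h))
    (fun k r hr I => hr (k :: I)) hc (C_mem_valuesIn (hO _))
    (fun k => by ext I; rcases I with _ | _ <;> simp)
    σ (fun m p => C_mem_valuesIn (hσ m p)) N (vertex h)
    (IsUnit.of_mul_eq_one (vertex (-h)) (by rw [← vertex_add, add_neg_cancel, vertex_zero]))
    (fun k => by
      obtain ⟨γ, hγ⟩ := exists_derivation_vertex (fun {R} _ => shiftD k) (fun _ _ => rfl)
      refine ⟨C (η PowerSeries.X * h) * Shuffle.map (algebraMap ℝ K) γ,
        (valuesIn O).mul_mem (C_mem_valuesIn hh) fun w => ?_, ?_⟩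
      · rw [Shuffle.map_apply, ← hη]; exact hO _
      · rw [hγ, map_mul]; ring)
  refine ⟨PowerSeries.map ev q, ?_, fun n => ?_⟩
  · have h := congrArg (PowerSeries.map ev) hq
    rw [map_mul, map_mul, map_theta, PowerSeries.map_C] at h
    exact h
  · rw [PowerSeries.coeff_map]
    exact hq' n []

/-- On graded series `z d/dz` is the Euler derivation, and the Euler logarithmic derivative of the
three-point coefficients is linear in `h`. -/
theorem grade_vertex_logDeriv (hη : ∀ r, η (PowerSeries.C r) = algebraMap ℝ K r)
    (hO : ∀ s, η s ∈ O) (hh : η PowerSeries.X * h ∈ O) :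
    ∃ q : PowerSeries (Shuffle K),
      PowerSeries.C (C (η PowerSeries.X)) * theta (grade (vertex h)) = grade (vertex h) * q
      ∧ ∀ n w, PowerSeries.coeff n q w ∈ O := by
  obtain ⟨γ, hγ⟩ := exists_derivation_vertex (fun {R} _ => euler)
    (fun φ f => by ext w; simp)
  refine ⟨grade (C (η PowerSeries.X * h) * Shuffle.map (algebraMap ℝ K) γ), ?_, fun n w => ?_⟩
  · rw [theta_grade, C_mul_grade, ← grade_mul, hγ, map_mul]
    congr 1; ring
  · rw [coeff_grade]
    split_ifs
    · rw [C_mul_apply, Shuffle.map_apply, ← hη]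
      exact O.mul_mem hh (hO _)
    · exact O.zero_mem

theorem formSymbol_perm_right (hη : ∀ r, η (PowerSeries.C r) = algebraMap ℝ K r)
    (hc : η PowerSeries.X * c = 1) (w : List ℕ) {I I' : List ℕ} (hI : I.Perm I') :
    η (formSymbol w I []) = η (formSymbol w I' []) := by
  rw [formSymbol_nil_right η hη hc, formSymbol_nil_right η hη hc, form_perm_left c hI]

theorem flow_update {R : Type*} [CommRing R] (ι : K →+* R) (D : ℕ → Der R) (a c : K)
    (σ : ∀ m, Part m → K) (N : ℕ) (s : Part (N + 1) → K) (Ψ : R) :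
    flow ι a c D (Function.update σ (N + 1) s) (N + 1) Ψ (N + 1) = flow ι a c D σ N Ψ (N + 1)
      + ι (algebraMap ℝ K ((N + 1 : ℕ) : ℝ)⁻¹ * c) * ∑ r, ι (s r) * opWord (ι a) D r.word Ψ := by
  have hσ : ∀ m ≤ N, σ m = Function.update σ (N + 1) s m := fun m hm => by
    rw [Function.update_of_ne (by omega)]
  rw [flow_of_ne_zero _ _ _ _ _ _ _ (Nat.succ_ne_zero N),
    flow_of_ne_zero _ _ _ _ _ _ _ (Nat.succ_ne_zero N), Finset.sum_range_succ, if_pos le_rfl, mul_add,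
    Nat.sub_self, flow_zero, Function.update_self]
  congr 2
  refine Finset.sum_congr rfl fun m hm => ?_
  rw [Finset.mem_range] at hm
  split_ifs
  · rw [hσ _ (by omega), flow_congr ι D (Nat.le_succ N) hσ _ (by omega)]
  · rfl

/-- The rescaled Gram matrix has its inverse over power series in `1 / c`, so the linear system is
solvable without leaving `O`. -/
theorem exists_combination_eq (hη : ∀ r, η (PowerSeries.C r) = algebraMap ℝ K r)
    (hO : ∀ s, η s ∈ O) (hc : η PowerSeries.X * c = 1) {n : ℕ} {v : Shuffle K} (hv : IsSymm v)
    (hv0 : ∀ I, wt I ≠ n → v I = 0) (hvO : ∀ I, v I ∈ O) :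
    ∃ s : Part n → K, (∀ r, s r ∈ O) ∧ ∀ I, ∑ r, s r * η (formSymbol r.word I []) = v I := by
  let M := gramSeries n
  let s : Part n → K := fun r => ∑ r', η (M⁻¹ r r') * v r'.word
  have hMs : ∀ r', ∑ r, η (M r' r) * s r = v r'.word := by
    intro r'
    have hM : M * M⁻¹ = 1 := Matrix.mul_nonsing_inv _ (isUnit_det_gramSeries _)
    simp only [s, Finset.mul_sum]
    rw [Finset.sum_comm]
    have : ∀ t, ∑ r, η (M r' r) * (η (M⁻¹ r t) * v t.word) = if r' = t then v t.word else 0 := by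
      intro t
      have h1 := congrArg η (congrFun (congrFun hM r') t)
      rw [Matrix.mul_apply, map_sum, Matrix.one_apply] at h1
      simp only [map_mul] at h1
      simp only [← mul_assoc]
      rw [← Finset.sum_mul, h1]
      split_ifs <;> simp
    simp only [this]
    simp
  refine ⟨s, fun r => O.sum_mem fun r' _ => O.mul_mem (hO _) (hvO _), fun I => ?_⟩
  by_cases hI : wt I = n
  · obtain ⟨r', hr'⟩ := exists_word_perm_of_wt hI
    rw [hv _ _ hr', ← hMs]
    refine Finset.sum_congr rfl fun r _ => ?_
    rw [formSymbol_perm_right hη hc _ hr', mul_comm]; rfl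
  · rw [hv0 I hI]
    refine Finset.sum_eq_zero fun r _ => ?_
    rw [formSymbol_nil_right η hη hc, form_eq_zero_of_wt _ (by rwa [r.wt_word]), mul_zero, mul_zero]

/-- The symbols are built one level at a time. The target and the flow built so far both have
regular logarithmic derivatives, which is what keeps the next symbol regular. -/
theorem exists_flow_form_eq_vertex (hη : ∀ r, η (PowerSeries.C r) = algebraMap ℝ K r)
    (hO : ∀ s, η s ∈ O) (hc : η PowerSeries.X * c = 1) (hh : η PowerSeries.X * h ∈ O) (N : ℕ) :
    ∃ σ : ∀ m, Part m → K, (∀ m p, σ m p ∈ O) ∧ ∀ n ≤ N, ∀ I,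
      flow C (η PowerSeries.X) c shiftD σ N (form c I) n [] = if wt I = n then vertex h I else 0 := by
  induction N with
  | zero =>
    refine ⟨fun _ _ => 0, fun _ _ => O.zero_mem, fun n hn I => ?_⟩
    obtain rfl := Nat.le_zero.1 hn
    rw [flow_zero, form_nil_right]
    rcases I with _ | ⟨i, I⟩
    · rw [one_nil, wt_nil, if_pos rfl, vertex_apply, sortWord_nil]; rfl
    · rw [one_cons, if_neg (by rw [wt_cons]; omega)]
  | succ N ih =>
    obtain ⟨σ, hσ, hN⟩ := ih
    obtain ⟨p, hp, hp'⟩ := flow_form_logDeriv hη hO hc σ hσ N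
    obtain ⟨q, hq, hq'⟩ := grade_vertex_logDeriv (h := h) hη hO hh
    set f : PowerSeries (Shuffle K) := PowerSeries.mk fun n =>
      mk fun I => flow C (η PowerSeries.X) c shiftD σ N (form c I) n [] with hf
    have hfg : ∀ n ≤ N, PowerSeries.coeff n f = PowerSeries.coeff n (grade (vertex h)) := by
      intro n hn
      ext I
      rw [hf, PowerSeries.coeff_mk, mk_apply, hN n hn, coeff_grade]
    have hg0 : PowerSeries.coeff 0 (grade (vertex h)) = 1 := by
      ext I
      rw [coeff_grade]
      rcases I with _ | ⟨i, I⟩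
      · rw [one_nil, wt_nil, if_pos rfl, vertex_apply, sortWord_nil]; rfl
      · rw [one_cons, if_neg (by rw [wt_cons]; omega)]
    -- The two series agree through level `N`, so `(N + 1) / c` times the discrepancy at the next
    -- level is a difference of regular coefficients.
    have hv := coeff_logDeriv_sub ((hfg 0 (Nat.zero_le _)).trans hg0) hg0 hp hq (N + 1)
      fun j hj => hfg j (by omega)
    set v : Shuffle K := PowerSeries.coeff (N + 1) q - PowerSeries.coeff (N + 1) p with hv'
    have hvO : ∀ I, v I ∈ O := fun I => by
      rw [hv', Shuffle.sub_apply]; exact O.sub_mem (hq' _ _) (hp' _ _)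
    have hvI : ∀ I, v I = ((N + 1 : ℕ) : K) * (η PowerSeries.X *
        ((if wt I = N + 1 then vertex h I else 0) -
          flow C (η PowerSeries.X) c shiftD σ N (form c I) (N + 1) [])) := by
      intro I
      rw [← hv, natCast_mul_apply, C_mul_apply, Shuffle.sub_apply, coeff_grade, hf,
        PowerSeries.coeff_mk, mk_apply]
    obtain ⟨x, hx⟩ := exists_flow_eq_sum (η PowerSeries.X) c σ N (N + 1)
    have hvp : ∀ {I I' : List ℕ}, I.Perm I' → v I = v I' := by
      intro I I' hI
      rw [hvI, hvI, wt_perm hI, isSymm_vertex h I I' hI, form_perm_left c hI]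
    have hv0 : ∀ {I : List ℕ}, wt I ≠ N + 1 → v I = 0 := by
      intro I hI
      rw [hvI, if_neg hI, hx _ (isSymm_form c I), Finset.sum_eq_zero, sub_zero, mul_zero, mul_zero]
      intro r _
      rw [form_eq_zero_of_wt, mul_zero]
      rw [r.wt_word]; exact hI
    -- The new symbol changes level `N + 1` by `c / (N + 1)` times `v`, which is exactly the
    -- discrepancy.
    obtain ⟨s, hsO, hs⟩ := exists_combination_eq hη hO hc (fun _ _ => hvp) (fun I => hv0) hvO
    let σ' : ∀ m, Part m → K := Function.update σ (N + 1) s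
    have hσσ' : ∀ m ≤ N, σ m = σ' m := fun m hm => by
      simp only [σ']; rw [Function.update_of_ne (by omega)]
    refine ⟨σ', fun m r => ?_, fun n hn I => ?_⟩
    · by_cases hm : m = N + 1
      · subst hm
        simp only [σ', Function.update_self]
        exact hsO r
      · simp only [σ', Function.update_of_ne hm]
        exact hσ m r
    · rcases hn.lt_or_eq with hn | rfl
      · rw [← flow_congr C shiftD (Nat.le_succ N) hσσ' _ (by omega), hN n (by omega)]
      · have e : flow C (η PowerSeries.X) c shiftD σ' (N + 1) (form c I) (N + 1) []
            = flow C (η PowerSeries.X) c shiftD σ N (form c I) (N + 1) []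
              + algebraMap ℝ K ((N + 1 : ℕ) : ℝ)⁻¹ * c * v I := by
          rw [flow_update, Shuffle.add_apply, C_mul_apply, ← hs, Shuffle.sum_apply]
          congr 2
          refine Finset.sum_congr rfl fun r _ => ?_
          rw [C_mul_apply, opWord_shiftD, formSymbol_nil_right η hη hc, List.append_nil,
            isSymm_form c I _ _ (List.reverse_perm r.word)]
        have h1 : algebraMap ℝ K ((N + 1 : ℕ) : ℝ)⁻¹ * ((N + 1 : ℕ) : K) = 1 := by
          rw [← map_natCast (algebraMap ℝ K), ← map_mul, inv_mul_cancel₀ (by positivity), map_one]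
        rw [e, hvI]
        generalize flow C (η PowerSeries.X) c shiftD σ N (form c I) (N + 1) [] = A
        generalize (if wt I = N + 1 then vertex h I else 0) = B
        linear_combination (B - A) * h1 + (B - A) * algebraMap ℝ K ((N + 1 : ℕ) : ℝ)⁻¹ *
          ((N + 1 : ℕ) : K) * hc

/-- The coefficients of the block satisfy a first order equation with regular coefficients. -/
theorem exists_block_logDeriv (hη : ∀ r, η (PowerSeries.C r) = algebraMap ℝ K r)
    (hO : ∀ s, η s ∈ O) (hc : η PowerSeries.X * c = 1) (hh : η PowerSeries.X * h ∈ O) (N : ℕ) :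
    ∃ (x : ∀ n, Part n → K) (F q : PowerSeries K),
      (∀ n ≤ N, ∀ p : Part n, ∑ r : Part n, form c p.word r.word * x n r = vertex h p.word) ∧
      (∀ n, PowerSeries.coeff n F = ∑ p : Part n, vertex h p.word * x n p) ∧
      PowerSeries.C (η PowerSeries.X) * theta F = F * q ∧ ∀ n, PowerSeries.coeff n q ∈ O := by
  obtain ⟨σ, hσ, hN⟩ := exists_flow_form_eq_vertex hη hO hc hh N
  obtain ⟨q, hq, hq'⟩ := flow_vertex_logDeriv hη hO hc hh σ hσ N
  -- At each level the flow is one linear functional `x`. On the rows of the form it returns the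
  -- three-point coefficients, so `G x = ρ`; on the three-point coefficients it returns `ρᵀ x`.
  choose x hx using fun n => exists_flow_eq_sum (η PowerSeries.X) c σ N n
  refine ⟨x, _, q, fun n hn p => ?_, fun n => ?_, hq, hq'⟩
  · have := hN n hn p.word
    rw [hx n _ (isSymm_form c _), p.wt_word, if_pos rfl] at this
    rw [← this]
    exact Finset.sum_congr rfl fun _ _ => mul_comm _ _
  · rw [PowerSeries.coeff_mk, hx n _ (isSymm_vertex h)]
    exact Finset.sum_congr rfl fun _ _ => mul_comm _ _

end Existence

/-! ### The block in terms of the reduced Gram matrix -/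

section Solve

variable {K : Type} [CommRing K] [Algebra ℝ K] {η : PowerSeries ℝ →+* K} {c : K}

/-- In the unknowns `c ^ r y` the Gram system has the invertible rescaled matrix. -/
theorem pow_mul_eq_of_form (hη : ∀ r, η (PowerSeries.C r) = algebraMap ℝ K r)
    (hc : η PowerSeries.X * c = 1) {n : ℕ} {y v : Part n → K}
    (hy : ∀ p, ∑ r : Part n, form c p.word r.word * y r = v p) (r : Part n) :
    c ^ r.word.length * y r = ∑ p, η ((gramSeries n)⁻¹ r p) * v p := by
  have h1 : ∀ p, ∑ q, η (gramSeries n p q) * (c ^ q.word.length * y q) = v p := by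
    intro p
    rw [← hy p]
    refine Finset.sum_congr rfl fun q _ => ?_
    have h2 : η (gramSeries n p q) = η PowerSeries.X ^ q.word.length * form c p.word q.word :=
      formSymbol_nil_right η hη hc _ _
    have h3 : η PowerSeries.X ^ q.word.length * c ^ q.word.length = 1 := by
      rw [← mul_pow, hc, one_pow]
    rw [h2]
    linear_combination (form c p.word q.word * y q) * h3
  have hM : (gramSeries n)⁻¹ * gramSeries n = 1 := Matrix.nonsing_inv_mul _ (isUnit_det_gramSeries n)
  have h4 := congrArg (fun A : Matrix (Part n) (Part n) K => A.mulVec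
    (fun q => c ^ q.word.length * y q) r) (congrArg (RingHom.mapMatrix η) hM)
  simp only [map_mul, map_one, Matrix.one_mulVec, ← Matrix.mulVec_mulVec] at h4
  rw [← h4, Matrix.mulVec, dotProduct]
  exact Finset.sum_congr rfl fun p _ => congrArg _ (h1 p)

theorem eq_of_form (hη : ∀ r, η (PowerSeries.C r) = algebraMap ℝ K r)
    (hc : η PowerSeries.X * c = 1) {n : ℕ} {x y : Part n → K}
    (h : ∀ p : Part n, ∑ r : Part n, form c p.word r.word * x r = ∑ r : Part n, form c p.word r.word * y r) :
    x = y := by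
  funext r
  have h1 := (pow_mul_eq_of_form hη hc h r).trans (pow_mul_eq_of_form hη hc (fun _ => rfl) r).symm
  have h3 : η PowerSeries.X ^ r.word.length * c ^ r.word.length = 1 := by
    rw [← mul_pow, hc, one_pow]
  linear_combination η PowerSeries.X ^ r.word.length * h1 - (x r - y r) * h3

theorem coeff_zero_of_form {h : K} {x : Part 0 → K}
    (hx : ∀ p : Part 0, ∑ r : Part 0, form c p.word r.word * x r = vertex h p.word) :
    ∑ p : Part 0, vertex h p.word * x p = 1 := by
  have hw : ∀ p : Part 0, p.word = [] := by
    intro p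
    have := p.wt_word
    rcases hp : p.word with _ | ⟨a, w⟩
    · rfl
    · rw [hp, wt_cons] at this; omega
  have hv : vertex h [] = 1 := by rw [vertex_apply, sortWord_nil]; rfl
  obtain ⟨p, -⟩ : ∃ p : Part 0, List.Perm [] p.word := exists_word_perm_of_wt rfl
  have h1 := hx p
  simp only [hw, form_nil_right, one_nil, hv] at h1 ⊢
  exact h1

/-- The coefficients of the block satisfy a first order equation with regular coefficients. -/
theorem exists_series_logDeriv {O : Subring K} {h : K}
    (hη : ∀ r, η (PowerSeries.C r) = algebraMap ℝ K r)
    (hO : ∀ s, η s ∈ O) (hc : η PowerSeries.X * c = 1) (hh : η PowerSeries.X * h ∈ O) :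
    ∃ (x : ∀ n, Part n → K) (F q : PowerSeries K),
      (∀ n, ∀ p : Part n, ∑ r : Part n, form c p.word r.word * x n r = vertex h p.word) ∧
      (∀ n, PowerSeries.coeff n F = ∑ p : Part n, vertex h p.word * x n p) ∧
      PowerSeries.C (η PowerSeries.X) * theta F = F * q ∧ ∀ n, PowerSeries.coeff n q ∈ O := by
  choose x F q hx hF hq hqO using fun N => exists_block_logDeriv hη hO hc hh N
  -- Solutions of the Gram system are unique, so the data obtained up to different levels `N` agree
  -- where they overlap and glue along the diagonal.
  have hxN : ∀ n N, n ≤ N → x N n = x n n := fun n N hn =>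
    eq_of_form hη hc fun p => (hx N n hn p).trans (hx n n le_rfl p).symm
  have hFN : ∀ n N, n ≤ N → PowerSeries.coeff n (F N) = PowerSeries.coeff n (F n) := fun n N hn => by
    rw [hF, hF, hxN n N hn]
  have hF0 : ∀ N, PowerSeries.coeff 0 (F N) = 1 := fun N => by
    rw [hF]; exact coeff_zero_of_form (hx N 0 (Nat.zero_le _))
  have hqN : ∀ n N, n ≤ N → PowerSeries.coeff n (q N) = PowerSeries.coeff n (q n) := fun n N hn => by
    have h1 := coeff_logDeriv_sub (hF0 n) (hF0 N) (hq n) (hq N) n fun j hj => by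
      rw [hFN j N (by omega), hFN j n hj.le]
    rw [hFN n N hn, sub_self, mul_zero, mul_zero] at h1
    exact (sub_eq_zero.1 h1.symm)
  refine ⟨fun n => x n n, PowerSeries.mk fun n => PowerSeries.coeff n (F n),
    PowerSeries.mk fun n => PowerSeries.coeff n (q n), fun n => hx n n le_rfl, fun n => ?_, ?_, fun n => ?_⟩
  · rw [PowerSeries.coeff_mk, hF]
  · ext n
    have h1 := congrArg (PowerSeries.coeff n) (hq n)
    rw [PowerSeries.coeff_C_mul, coeff_theta, PowerSeries.coeff_mul] at h1 ⊢
    rw [PowerSeries.coeff_mk, h1]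
    refine Finset.sum_congr rfl fun ij hij => ?_
    rw [Finset.HasAntidiagonal.mem_antidiagonal] at hij
    rw [PowerSeries.coeff_mk, PowerSeries.coeff_mk, hFN _ n (by omega), hqN _ n (by omega)]
  · rw [PowerSeries.coeff_mk]; exact hqO n n

end Solve

/-! ### Discarding partitions with a part equal to one -/

section BlockCoeff

theorem wordOf_eq_append_one {n : ℕ} (p : Nat.Partition n) (hp : 1 ∈ p.parts) :
    ∃ I, wordOf p = I ++ [1] := by
  have h1 : 1 ∈ wordOf p := (Multiset.mem_sort _).2 hp
  have h2 : (wordOf p).Pairwise (· ≥ ·) := Multiset.pairwise_sort _ _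
  have h3 : ∀ k ∈ wordOf p, 0 < k := fun k hk => p.parts_pos ((Multiset.mem_sort _).1 hk)
  rcases List.eq_nil_or_concat' (wordOf p) with h | ⟨I, a, h⟩
  · rw [h] at h1; simp at h1
  · refine ⟨I, ?_⟩
    rw [h] at h1 h2 h3 ⊢
    rw [List.pairwise_append] at h2
    have h4 := h3 a (by simp)
    rcases List.mem_append.1 h1 with h5 | h5
    · have := h2.2.2 1 h5 a (by simp)
      rw [show a = 1 by omega]
    · rw [List.mem_singleton.1 h5]

variable {F : Type} [Field F]

theorem threePoint_append_one (h : F) (I : List ℕ) : threePoint h 0 (I ++ [1]) = 0 := by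
  induction I with
  | nil => simp [threePoint]
  | cons k I ih => rw [List.cons_append, threePoint, ih, mul_zero]

theorem threePoint_zero (h : F) (w : List ℕ) : threePoint h 0 w = vertexAt h w := by
  induction w with
  | nil => rfl
  | cons k w ih => rw [threePoint, vertexAt, ih, zero_add]

theorem sum_part {n : ℕ} (f : Nat.Partition n → F) (hf : ∀ p, 1 ∈ p.parts → f p = 0) :
    ∑ p, f p = ∑ p : Part n, f p.1 := by
  rw [← Fintype.sum_subtype_add_sum_subtype (fun p : Nat.Partition n => 1 ∉ p.parts) f,
    add_eq_left]
  exact Finset.sum_eq_zero fun p _ => hf p.1 (not_not.1 p.2)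

theorem threePointVec_part (h : F) {n : ℕ} (p : Part n) :
    threePointVec h 0 n p.1 = vertex h p.word := by
  rw [threePointVec, threePoint_zero, vertex_apply, p.sortWord_word, p.map_word]

variable [Algebra ℝ F]

theorem gram_part (c : F) {n : ℕ} (p q : Part n) :
    gram c 0 n p.1 q.1 = form c p.word q.word := by
  rw [gram, Matrix.of_apply, shapovalov_eq, form_apply, p.sortWord_word, q.sortWord_word, p.map_word,
    q.map_word]
  rw [show c / 12 = algebraMap ℝ F (1 / 12) * c by rw [map_div₀, map_one, map_ofNat]; ring]

/-- In a non-increasing word a letter 1 stands last, next to the vacuum. The corresponding rows,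
columns and three-point coefficients all vanish. -/
theorem mulVec_gram_eq_iff (h c : F) (n : ℕ) (x : Nat.Partition n → F) :
    (gram c 0 n).mulVec x = threePointVec h 0 n ↔
      ∀ p : Part n, ∑ r : Part n, form c p.word r.word * x r.1 = vertex h p.word := by
  have key : ∀ p, (gram c 0 n).mulVec x p = ∑ r : Part n, gram c 0 n p r.1 * x r.1 := by
    intro p
    refine sum_part (fun q => gram c 0 n p q * x q) fun q hq => ?_
    obtain ⟨J, hJ⟩ := wordOf_eq_append_one q hq
    rw [gram, Matrix.of_apply, shapovalov_eq, hJ, shap_append_one_right, zero_mul]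
  constructor
  · intro hx p
    have := congrFun hx p.1
    rw [key, threePointVec_part] at this
    simpa only [gram_part] using this
  · intro hx
    funext p
    rw [key]
    by_cases hp : 1 ∈ p.parts
    · obtain ⟨J, hJ⟩ := wordOf_eq_append_one p hp
      rw [threePointVec, hJ, threePoint_append_one]
      refine Finset.sum_eq_zero fun q _ => ?_
      rw [gram, Matrix.of_apply, shapovalov_eq, hJ, shap_append_one_left]
      exact zero_mul _
    · have := hx ⟨p, hp⟩
      rw [← threePointVec_part] at this
      rw [← this]
      exact Finset.sum_congr rfl fun r _ => congrArg (· * x r.1) (gram_part c ⟨p, hp⟩ r)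

/-- `blockCoeff` uses an arbitrary solution. Its entries at partitions without ones are forced, and
the other entries are paired with zero. -/
theorem blockCoeff_eq {h c : F} {n : ℕ} {x : Part n → F}
    (hinj : ∀ y : Part n → F, (∀ p : Part n, ∑ r : Part n, form c p.word r.word * y r = vertex h p.word)
      → y = x)
    (hx : ∀ p : Part n, ∑ r : Part n, form c p.word r.word * x r = vertex h p.word) :
    blockCoeff h 0 c n = ∑ p : Part n, vertex h p.word * x p := by
  classical
  have hex : ∃ y : Nat.Partition n → F, (gram c 0 n).mulVec y = threePointVec h 0 n := by
    refine ⟨fun p => if hp : 1 ∉ p.parts then x ⟨p, hp⟩ else 0, (mulVec_gram_eq_iff h c n _).2 ?_⟩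
    intro p
    rw [← hx p]
    refine Finset.sum_congr rfl fun r _ => ?_
    rw [dif_pos r.2]
  rw [blockCoeff, dif_pos hex]
  have h1 := hinj _ ((mulVec_gram_eq_iff h c n _).1 hex.choose_spec)
  rw [dotProduct, sum_part]
  · refine Finset.sum_congr rfl fun p _ => ?_
    rw [threePointVec_part, ← h1]
  · intro p hp
    obtain ⟨J, hJ⟩ := wordOf_eq_append_one p hp
    rw [threePointVec, hJ, threePoint_append_one, zero_mul]

end BlockCoeff

/-! ### The dependence of the block on the dimension -/

theorem map_form_apply {K K' : Type} [CommRing K] [CommRing K'] [Algebra ℝ K] [Algebra ℝ K'] (φ : K →+* K')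
    (hφ : ∀ r, φ (algebraMap ℝ K r) = algebraMap ℝ K' r) (c : K) (I J : List ℕ) :
    φ (form c I J) = form (φ c) I J := by
  rw [← map_form φ hφ]; rfl

theorem map_vertex_apply {K K' : Type} [CommRing K] [CommRing K'] (φ : K →+* K') (h : K) (I : List ℕ) :
    φ (vertex h I) = vertex (φ h) I := by
  rw [← map_vertex φ]; rfl

theorem dvd_vertexAt {K : Type} [CommRing K] (h : K) {w : List ℕ} (hw : w ≠ []) : h ∣ vertexAt h w := by
  induction w with
  | nil => exact absurd rfl hw
  | cons k w ih =>
    rw [vertexAt]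
    by_cases hw' : w = []
    · subst hw'
      exact Dvd.dvd.mul_right ⟨(k : K) - 1, by rw [List.sum_nil, Nat.cast_zero]; ring⟩ _
    · exact Dvd.dvd.mul_left (ih hw') _

theorem Part.word_ne_nil {n : ℕ} (hn : n ≠ 0) (p : Part n) : p.word ≠ [] := fun h => hn (by
  rw [← p.wt_word, h, wt_nil])

theorem dvd_vertex {K : Type} [CommRing K] (h : K) {n : ℕ} (hn : n ≠ 0) (p : Part n) :
    h ∣ vertex h p.word := by
  rw [vertex_apply, p.sortWord_word]
  exact dvd_vertexAt h fun h1 => p.word_ne_nil hn (List.map_eq_nil_iff.1 h1)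

/-- The linear part of the three-point coefficients. -/
def vertexLinear (w : List ℕ) : ℝ := (vertex (Polynomial.X : Polynomial ℝ) w).coeff 1

theorem coeff_one_vertex {F : Type} [Field F] [Algebra ℝ F] (c : F) (w : List ℕ) :
    (vertex (Polynomial.X * Polynomial.C c) w).coeff 1 = algebraMap ℝ F (vertexLinear w) * c := by
  have h1 : vertex (Polynomial.X * Polynomial.C c) w = (Polynomial.mapRingHom (algebraMap ℝ F)
      (vertex (Polynomial.X : Polynomial ℝ) w)).comp (Polynomial.C c * Polynomial.X) := by
    rw [map_vertex_apply, ← Polynomial.coe_compRingHom_apply, map_vertex_apply,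
      Polynomial.coe_compRingHom_apply, Polynomial.coe_mapRingHom, Polynomial.map_X,
      Polynomial.X_comp, mul_comm]
  rw [h1, Polynomial.comp_C_mul_X_coeff, Polynomial.coe_mapRingHom, Polynomial.coeff_map, pow_one]
  rfl

section Leading

variable {F : Type} [Field F] [Algebra ℝ F] {η : PowerSeries ℝ →+* F} {c : F}
  {n : ℕ} {x : Part n → Polynomial F}

/-- The polynomial variable is `ε = h / c`. The three-point coefficients at positive level are
divisible by `h`, so the constant term in `ε` solves the homogeneous system. -/
theorem coeff_zero_of_form_poly (hη : ∀ r, η (PowerSeries.C r) = algebraMap ℝ F r)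
    (hc : η PowerSeries.X * c = 1) (hn : n ≠ 0)
    (hx : ∀ p : Part n, ∑ r : Part n, form (Polynomial.C c) p.word r.word * x r
      = vertex (Polynomial.X * Polynomial.C c) p.word) (p : Part n) : (x p).coeff 0 = 0 := by
  have h1 : (fun r => (x r).coeff 0) = fun _ => 0 := by
    refine eq_of_form hη hc fun p => ?_
    have h2 := congrArg (fun f => Polynomial.coeff f 0) (hx p)
    simp only [Polynomial.finsetSum_coeff] at h2
    have h3 : ∀ r : Part n, form (Polynomial.C c) p.word r.word
        = Polynomial.C (form c p.word r.word) := fun r =>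
      (map_form_apply (Polynomial.C : F →+* Polynomial F) (fun _ => rfl) c _ _).symm
    simp only [h3, Polynomial.coeff_C_mul] at h2
    rw [h2, Finset.sum_eq_zero fun _ _ => mul_zero _]
    obtain ⟨f, hf⟩ := dvd_vertex (Polynomial.X * Polynomial.C c) hn p
    rw [hf, mul_assoc, Polynomial.coeff_X_mul_zero]
  exact congrFun h1 p

/-- The solution of the classical linear system. -/
def classicalSolution (n : ℕ) (r : Part n) : PowerSeries ℝ :=
  ∑ p, (gramSeries n)⁻¹ r p * PowerSeries.C (vertexLinear p.word)

/-- A word of length `r` costs `c ^ (-r)`; the right-hand side, linear in `h = ε c`, gives one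
factor `c` back, whence the exponent `r - 1`. -/
theorem coeff_one_of_form_poly (hη : ∀ r, η (PowerSeries.C r) = algebraMap ℝ F r)
    (hc : η PowerSeries.X * c = 1) (hn : n ≠ 0)
    (hx : ∀ p : Part n, ∑ r : Part n, form (Polynomial.C c) p.word r.word * x r
      = vertex (Polynomial.X * Polynomial.C c) p.word) (r : Part n) :
    (x r).coeff 1 = η (PowerSeries.X ^ (r.word.length - 1) * classicalSolution n r) := by
  have h1 : ∀ p : Part n, ∑ r : Part n, form c p.word r.word * (x r).coeff 1
      = algebraMap ℝ F (vertexLinear p.word) * c := by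
    intro p
    have h2 := congrArg (fun f => Polynomial.coeff f 1) (hx p)
    simp only [Polynomial.finsetSum_coeff] at h2
    have h3 : ∀ r : Part n, form (Polynomial.C c) p.word r.word
        = Polynomial.C (form c p.word r.word) := fun r =>
      (map_form_apply (Polynomial.C : F →+* Polynomial F) (fun _ => rfl) c _ _).symm
    simp only [h3, Polynomial.coeff_C_mul] at h2
    rw [h2, coeff_one_vertex]
  have h2 := pow_mul_eq_of_form hη hc h1 r
  have h3 : ∑ p, η ((gramSeries n)⁻¹ r p) * (algebraMap ℝ F (vertexLinear p.word) * c)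
      = η (classicalSolution n r) * c := by
    rw [classicalSolution, map_sum, Finset.sum_mul]
    exact Finset.sum_congr rfl fun p _ => by rw [map_mul, hη, mul_assoc]
  have hl : r.word.length = (r.word.length - 1) + 1 := by
    have := List.length_pos_iff.2 (r.word_ne_nil hn); omega
  have h4 : η PowerSeries.X ^ r.word.length * c ^ r.word.length = 1 := by
    rw [← mul_pow, hc, one_pow]
  rw [h3] at h2
  have h5 : (x r).coeff 1 = η PowerSeries.X ^ r.word.length * (η (classicalSolution n r) * c) := by
    rw [← h2, ← mul_assoc, h4, one_mul]
  rw [h5, hl, Nat.add_sub_cancel, pow_succ, map_mul, map_pow]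
  linear_combination η PowerSeries.X ^ (r.word.length - 1) * η (classicalSolution n r) * hc

theorem coeff_mul_of_coeff_zero {R : Type*} [CommRing R] {f g : Polynomial R} (hf : f.coeff 0 = 0)
    (hg : g.coeff 0 = 0) : Polynomial.X ^ 2 ∣ f * g ∧ (f * g).coeff 2 = f.coeff 1 * g.coeff 1 := by
  obtain ⟨f, rfl⟩ := Polynomial.X_dvd_iff.2 hf
  obtain ⟨g, rfl⟩ := Polynomial.X_dvd_iff.2 hg
  refine ⟨⟨f * g, by ring⟩, ?_⟩
  rw [show Polynomial.X * f * (Polynomial.X * g) = Polynomial.X * (Polynomial.X * (f * g)) by ring,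
    Polynomial.coeff_X_mul, Polynomial.coeff_X_mul, Polynomial.coeff_X_mul, Polynomial.coeff_X_mul,
    Polynomial.mul_coeff_zero]

theorem quadratic_of_form_poly (hη : ∀ r, η (PowerSeries.C r) = algebraMap ℝ F r)
    (hc : η PowerSeries.X * c = 1) (hn : n ≠ 0)
    (hx : ∀ p : Part n, ∑ r : Part n, form (Polynomial.C c) p.word r.word * x r
      = vertex (Polynomial.X * Polynomial.C c) p.word) :
    Polynomial.X ^ 2 ∣ ∑ p : Part n, vertex (Polynomial.X * Polynomial.C c) p.word * x p ∧
    η PowerSeries.X * (∑ p : Part n, vertex (Polynomial.X * Polynomial.C c) p.word * x p).coeff 2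
      = η (∑ p : Part n, PowerSeries.C (vertexLinear p.word) *
          (PowerSeries.X ^ (p.word.length - 1) * classicalSolution n p)) := by
  have h1 : ∀ p : Part n, (vertex (Polynomial.X * Polynomial.C c) p.word).coeff 0 = 0 := fun p => by
    obtain ⟨f, hf⟩ := dvd_vertex (Polynomial.X * Polynomial.C c) hn p
    rw [hf, mul_assoc, Polynomial.coeff_X_mul_zero]
  have h2 := fun p => coeff_mul_of_coeff_zero (h1 p) (coeff_zero_of_form_poly hη hc hn hx p)
  refine ⟨Finset.dvd_sum fun p _ => (h2 p).1, ?_⟩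
  rw [Polynomial.finsetSum_coeff, Finset.mul_sum, map_sum]
  refine Finset.sum_congr rfl fun p _ => ?_
  rw [(h2 p).2, coeff_one_vertex, coeff_one_of_form_poly hη hc hn hx, map_mul η (PowerSeries.C _), hη]
  linear_combination (algebraMap ℝ F (vertexLinear p.word) *
    η (PowerSeries.X ^ (p.word.length - 1) * classicalSolution n p)) * hc

end Leading

/-! ### The leading quadratic coefficient -/

theorem sum_classicalForm_classicalSolution {n : ℕ} (p : Part n) :
    ∑ q : Part n, classicalForm q.word p.word * PowerSeries.constantCoeff (classicalSolution n q)
      = vertexLinear p.word := by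
  have hM : gramSeries n * (gramSeries n)⁻¹ = 1 := Matrix.mul_nonsing_inv _ (isUnit_det_gramSeries n)
  have h1 : ∑ q, gramSeries n p q * classicalSolution n q = PowerSeries.C (vertexLinear p.word) := by
    have h2 := congrArg (fun A : Matrix (Part n) (Part n) (PowerSeries ℝ) => A.mulVec
      (fun q => PowerSeries.C (vertexLinear q.word)) p) hM
    simp only [Matrix.one_mulVec, ← Matrix.mulVec_mulVec] at h2
    exact h2
  have h3 := congrArg (PowerSeries.constantCoeff (R := ℝ)) h1
  rw [map_sum, PowerSeries.constantCoeff_C] at h3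
  rw [← h3]
  exact Finset.sum_congr rfl fun q _ => by rw [map_mul, constantCoeff_gramSeries]

theorem vertexLinear_singleton (k : ℕ) : vertexLinear [k] = k + 1 := by
  have : sortWord [k] = [k] := sortWord_of_pairwise (by simp)
  rw [vertexLinear, vertex_apply, this]
  simp only [List.map_cons, List.map_nil, vertexAt, List.sum_nil, Nat.cast_zero, zero_add, mul_one]
  rw [Polynomial.coeff_mul_X]
  push_cast
  rw [show (k : Polynomial ℝ) + 2 - 1 = Polynomial.C ((k : ℝ) + 1) by
    rw [map_add, map_natCast, map_one]; ring, Polynomial.coeff_C_zero]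

/-- Only the one-letter word survives at `1 / c = 0`. By triangularity its row of the classical
system involves no longer words, so its entry of the solution comes from a single scalar equation.
-/
theorem constantCoeff_quadratic {n : ℕ} (hn : n ≠ 0) :
    PowerSeries.constantCoeff (∑ p : Part n, PowerSeries.C (vertexLinear p.word) *
          (PowerSeries.X ^ (p.word.length - 1) * classicalSolution n p))
      = (12 * (n - 1) / (n * (n + 1)) : ℝ) := by
  rw [map_sum]
  have hlen : ∀ p : Part n, p.word.length ≠ 0 := fun p h => p.word_ne_nil hn (List.length_eq_zero_iff.1 h)
  have h0 : ∀ p : Part n, p.word.length ≠ 1 → PowerSeries.constantCoeff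
      (PowerSeries.C (vertexLinear p.word) *
        (PowerSeries.X ^ (p.word.length - 1) * classicalSolution n p)) = 0 := by
    intro p hp
    have := hlen p
    rw [map_mul, map_mul, map_pow, PowerSeries.constantCoeff_X, zero_pow (by omega), zero_mul, mul_zero]
  rcases Nat.lt_or_ge n 2 with hn2 | hn2
  · obtain rfl : n = 1 := by omega
    rw [Finset.sum_eq_zero]
    · simp
    · intro p _
      have h1 := p.wt_word
      rcases hp : p.word with _ | ⟨a, w⟩
      · exact absurd hp (p.word_ne_nil hn)
      · rw [hp, wt_cons] at h1; omega
  · obtain ⟨k, rfl⟩ := Nat.exists_eq_add_of_le' hn2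
    obtain ⟨p, hp⟩ : ∃ p : Part (k + 2), [k].Perm p.word := exists_word_perm_of_wt (by simp [wt])
    have hp : p.word = [k] := List.perm_singleton.1 hp.symm
    have huniq : ∀ q : Part (k + 2), q.word.length = 1 → q = p := by
      intro q hq
      obtain ⟨a, ha⟩ := List.length_eq_one_iff.1 hq
      have h1 := q.wt_word
      rw [ha] at h1
      have : a = k := by simpa [wt] using h1
      exact Part.eq_of_perm (by rw [ha, hp, this])
    rw [Finset.sum_eq_single p (fun q _ hq => h0 q fun h => hq (huniq q h))
      (fun h => absurd (Finset.mem_univ _) h)]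
    have h1 := sum_classicalForm_classicalSolution p
    rw [Finset.sum_eq_single p _ (fun h => absurd (Finset.mem_univ _) h)] at h1
    · rw [hp, vertexLinear_singleton, classicalForm, classicalForm, mul_one, classicalLog_singleton,
        if_pos rfl] at h1
      rw [hp, vertexLinear_singleton, map_mul, PowerSeries.constantCoeff_C, List.length_singleton,
        Nat.sub_self, pow_zero, one_mul]
      push_cast
      have hk : (0 : ℝ) ≤ k := Nat.cast_nonneg k
      rw [eq_div_iff (by positivity)]
      -- With `n = k + 2`, `n ^ 3 - n = (n - 1) n (n + 1)`; the factor `n - 1` is shared with the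
      -- three-point coefficient and cancels.
      have h2 : ((k : ℝ) + 1) * (((k : ℝ) + 2) * (k + 3) * PowerSeries.constantCoeff (classicalSolution (k + 2) p)
        - 12) = 0 := by linear_combination 12 * h1
      have h3 := (mul_eq_zero.1 h2).resolve_left (by positivity)
      linear_combination ((k : ℝ) + 1) * h3
    · intro q _ hq
      have h2 := hlen q
      have h3 : q.word.length ≠ 1 := fun h => hq (huniq q h)
      rw [classicalForm_eq_zero _ _ (by rw [hp, List.length_singleton]; omega), zero_mul]

/-! ### The logarithmic vacuum block -/

/-- If `f - 1` is of order two in the polynomial variable, the nonlinear terms of its logarithmic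
derivative are of order four. -/
theorem quadratic_logDeriv {R : Type*} [CommRing R] {x : R} {f q : PowerSeries (Polynomial R)}
    (h0 : PowerSeries.coeff 0 f = 1)
    (h : PowerSeries.C (Polynomial.C x) * theta f = f * q)
    (hf : ∀ n, n ≠ 0 → Polynomial.X ^ 2 ∣ PowerSeries.coeff n f) (n : ℕ) :
    Polynomial.X ^ 2 ∣ PowerSeries.coeff n q ∧
      (PowerSeries.coeff n q).coeff 2 = n * (x * (PowerSeries.coeff n f).coeff 2) := by
  have hn : ∀ n : ℕ, Polynomial.C x * ((n : Polynomial R) * PowerSeries.coeff n f) =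
      PowerSeries.coeff n q + ∑ ij ∈ (Finset.HasAntidiagonal.antidiagonal n).erase (0, n),
        PowerSeries.coeff ij.1 f * PowerSeries.coeff ij.2 q := by
    intro n
    have h1 := congrArg (PowerSeries.coeff n) h
    rw [PowerSeries.coeff_C_mul, coeff_theta, PowerSeries.coeff_mul,
      ← Finset.add_sum_erase _ _ (show (0, n) ∈ Finset.HasAntidiagonal.antidiagonal n by
        rw [Finset.HasAntidiagonal.mem_antidiagonal, zero_add]), h0, one_mul] at h1
    exact h1
  have hne : ∀ n : ℕ, ∀ ij ∈ (Finset.HasAntidiagonal.antidiagonal n).erase (0, n), ij.1 ≠ 0 := by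
    intro n ij hij h
    rw [Finset.mem_erase, Finset.HasAntidiagonal.mem_antidiagonal] at hij
    exact hij.1 (Prod.ext h (by simp only; omega))
  have hdvd : ∀ n, Polynomial.X ^ 2 ∣ PowerSeries.coeff n q := by
    intro n
    have h1 : PowerSeries.coeff n q = Polynomial.C x * ((n : Polynomial R) * PowerSeries.coeff n f)
      - ∑ ij ∈ (Finset.HasAntidiagonal.antidiagonal n).erase (0, n),
        PowerSeries.coeff ij.1 f * PowerSeries.coeff ij.2 q := by rw [hn, add_sub_cancel_right]
    rw [h1]
    refine dvd_sub (Dvd.dvd.mul_left ?_ _) (Finset.dvd_sum fun ij hij =>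
      Dvd.dvd.mul_right (hf _ (hne n ij hij)) _)
    by_cases h2 : n = 0
    · rw [h2, Nat.cast_zero, zero_mul]; exact dvd_zero _
    · exact Dvd.dvd.mul_left (hf n h2) _
  refine ⟨hdvd n, ?_⟩
  have h1 := congrArg (fun p => Polynomial.coeff p 2) (hn n)
  simp only [Polynomial.coeff_add, Polynomial.coeff_C_mul, Polynomial.coeff_natCast_mul,
    Polynomial.finsetSum_coeff] at h1
  rw [Finset.sum_eq_zero, add_zero] at h1
  · rw [← h1]; ring
  · intro ij hij
    obtain ⟨a, ha⟩ := hf _ (hne n ij hij)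
    obtain ⟨b, hb⟩ := hdvd ij.2
    rw [ha, hb, show Polynomial.X ^ 2 * a * (Polynomial.X ^ 2 * b)
      = Polynomial.X ^ 3 * (Polynomial.X * (a * b)) by ring, Polynomial.coeff_X_pow_mul']
    exact if_neg (by omega)

section Field

variable {F : Type} [Field F] [Algebra ℝ F] {η : PowerSeries ℝ →+* F} {c : F}

theorem map_eval_eq_block (hη : ∀ r, η (PowerSeries.C r) = algebraMap ℝ F r)
    (hc : η PowerSeries.X * c = 1) {x : ∀ n, Part n → Polynomial F} {f : PowerSeries (Polynomial F)}
    (hx : ∀ n, ∀ p : Part n, ∑ r : Part n, form (Polynomial.C c) p.word r.word * x n r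
      = vertex (Polynomial.X * Polynomial.C c) p.word)
    (hf : ∀ n, PowerSeries.coeff n f
      = ∑ p : Part n, vertex (Polynomial.X * Polynomial.C c) p.word * x n p) (ε : F) :
    PowerSeries.map (Polynomial.evalRingHom ε) f = block (ε * c) 0 c := by
  set e := Polynomial.evalRingHom ε with he
  have e1 : ∀ I J, e (form (Polynomial.C c) I J) = form c I J := fun I J => by
    rw [map_form_apply e (fun r => by rw [he, Polynomial.coe_evalRingHom]; exact Polynomial.eval_C)]
    rw [he, Polynomial.coe_evalRingHom, Polynomial.eval_C]
  have e2 : ∀ I, e (vertex (Polynomial.X * Polynomial.C c) I) = vertex (ε * c) I := fun I => by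
    rw [map_vertex_apply, he, Polynomial.coe_evalRingHom, Polynomial.eval_mul, Polynomial.eval_X,
      Polynomial.eval_C]
  have e3 : ∀ n, ∀ p : Part n, ∑ r : Part n, form c p.word r.word * e (x n r)
      = vertex (ε * c) p.word := fun n p => by
    rw [← e2, ← hx, map_sum]
    exact Finset.sum_congr rfl fun r _ => by rw [map_mul, e1]
  ext n
  rw [PowerSeries.coeff_map, hf, block, PowerSeries.coeff_mk, map_sum,
    blockCoeff_eq (fun y hy => eq_of_form hη hc fun p => (hy p).trans (e3 n p).symm) (e3 n)]
  exact Finset.sum_congr rfl fun p _ => by rw [map_mul, e2]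

/-- The logarithmic derivative of the vacuum block with `h = ε c` is `c` times a power series in `z`
whose coefficients are polynomials in `ε` over the power series in `1 / c`. -/
theorem exists_block_eq (hη : ∀ r, η (PowerSeries.C r) = algebraMap ℝ F r)
    (hη' : Function.Injective η) (hc : η PowerSeries.X * c = 1) :
    ∃ g : ℕ → Polynomial (PowerSeries ℝ),
      (∀ ε : F, PowerSeries.constantCoeff (block (ε * c) 0 c) = 1 ∧
        PowerSeries.C (η PowerSeries.X) * theta (block (ε * c) 0 c)
          = block (ε * c) 0 c * PowerSeries.mk fun n => (g n).eval₂ η ε) ∧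
      (∀ n, Polynomial.X ^ 2 ∣ g n) ∧
      ∀ n, PowerSeries.constantCoeff ((g n).coeff 2) = (n * (12 * (n - 1) / (n * (n + 1))) : ℝ) := by
  -- Taking `ε` as a polynomial variable and `O` as the polynomials in `ε` over power series in `1 /
  -- c` makes regularity mean the desired shape; `h / c = ε` lies in `O`.
  obtain ⟨x, f, q, hx, hf, hq, hqO⟩ := exists_series_logDeriv (K := Polynomial F)
    (η := Polynomial.C.comp η) (c := Polynomial.C c) (h := Polynomial.X * Polynomial.C c)
    (O := (Polynomial.mapRingHom η).range)
    (fun r => by rw [RingHom.comp_apply, hη]; rfl)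
    (fun s => ⟨Polynomial.C s, by simp⟩)
    (by rw [RingHom.comp_apply, ← Polynomial.C_mul, hc, Polynomial.C_1])
    ⟨Polynomial.X, by
      rw [Polynomial.coe_mapRingHom, Polynomial.map_X, RingHom.comp_apply, mul_left_comm,
        ← Polynomial.C_mul, hc, Polynomial.C_1, mul_one]⟩
  choose g hg using hqO
  simp only [Polynomial.coe_mapRingHom] at hg
  have hf0 : PowerSeries.coeff 0 f = 1 := by rw [hf]; exact coeff_zero_of_form (hx 0)
  have hquad := fun n (hn : n ≠ 0) => quadratic_of_form_poly hη hc hn (hx n)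
  have hq2 := quadratic_logDeriv hf0 hq (fun n hn => by rw [hf]; exact (hquad n hn).1)
  refine ⟨g, fun ε => ⟨?_, ?_⟩, fun n => ?_, fun n => ?_⟩
  · rw [← map_eval_eq_block hη hc hx hf, ← PowerSeries.coeff_zero_eq_constantCoeff_apply,
      PowerSeries.coeff_map, hf0, map_one]
  · have h1 := congrArg (PowerSeries.map (Polynomial.evalRingHom ε)) hq
    rw [map_mul, map_mul, map_theta, map_eval_eq_block hη hc hx hf, PowerSeries.map_C,
      RingHom.comp_apply, Polynomial.coe_evalRingHom, Polynomial.eval_C] at h1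
    rw [h1]
    congr 1
    ext n
    rw [PowerSeries.coeff_map, PowerSeries.coeff_mk, ← hg, Polynomial.coe_evalRingHom,
      Polynomial.eval_map]
  · have h1 := (hq2 n).1
    rw [Polynomial.X_pow_dvd_iff] at h1 ⊢
    intro d hd
    refine hη' ?_
    rw [map_zero, ← Polynomial.coeff_map, hg, h1 d hd]
  · have h1 := (hq2 n).2
    rw [← hg, Polynomial.coeff_map] at h1
    by_cases hn : n = 0
    · subst hn
      rw [Nat.cast_zero, zero_mul] at h1
      rw [hη' (h1.trans (map_zero η).symm)]; simp
    · rw [hf, (hquad n hn).2, ← map_natCast η, ← map_mul] at h1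
      rw [hη' h1, map_mul, constantCoeff_quadratic hn, map_natCast]

end Field

/-- The logarithmic derivative of a power series. -/
theorem theta_logOf {A : Type*} [CommRing A] [Algebra ℚ A] {f : PowerSeries A}
    (hf : PowerSeries.constantCoeff f = 1) : f * theta (PowerSeries.logOf f) = theta f := by
  have hs : PowerSeries.HasSubst (f - 1) :=
    PowerSeries.HasSubst.of_constantCoeff_zero' (by rw [map_sub, hf, map_one, sub_self])
  have h1 : (1 + PowerSeries.X) * PowerSeries.derivative A (PowerSeries.log A) = 1 := by
    rw [PowerSeries.deriv_log]
    ext n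
    rw [add_mul, one_mul, map_add]
    cases n with
    | zero => simp
    | succ n =>
      rw [PowerSeries.coeff_succ_X_mul, PowerSeries.coeff_mk, PowerSeries.coeff_mk,
        PowerSeries.coeff_one, if_neg (Nat.succ_ne_zero n), ← map_add, pow_succ]
      simp
  have h2 := congrArg (PowerSeries.subst (f - 1)) h1
  rw [PowerSeries.subst_mul hs, PowerSeries.subst_add hs, PowerSeries.subst_X hs] at h2
  have h3 : PowerSeries.subst (f - 1) (1 : PowerSeries A) = 1 := by
    rw [← PowerSeries.coe_substAlgHom hs, map_one]
  rw [h3] at h2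
  change f * (PowerSeries.X * PowerSeries.derivative A (PowerSeries.logOf f))
    = PowerSeries.X * PowerSeries.derivative A f
  rw [PowerSeries.logOf_eq, PowerSeries.derivative_subst hs, map_sub, Derivation.map_one_eq_zero, sub_zero]
  linear_combination (PowerSeries.X * PowerSeries.derivative A f) * h2

/-! ### Expansion near infinite central charge -/

theorem cPow_mul (a b : ℚ) : cPow a * cPow b = cPow (a + b) := by
  rw [cPow, cPow, HahnSeries.single_mul_single, mul_one, cPow, neg_add]

theorem cPow_zero : cPow 0 = 1 := by rw [cPow, neg_zero]; rfl

theorem cPow_pow (a : ℚ) (k : ℕ) : cPow a ^ k = cPow (k * a) := by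
  induction k with
  | zero => rw [pow_zero, Nat.cast_zero, zero_mul, cPow_zero]
  | succ k ih => rw [pow_succ, ih, cPow_mul]; push_cast; ring_nf

theorem coeff_cPow_mul (e a : ℚ) (x : LargeC) :
    (cPow e * x).coeff (-a) = x.coeff (e - a) := by
  have h := HahnSeries.coeff_single_mul_add (r := (1 : ℝ)) (x := x) (a := e - a) (b := -e)
  rw [one_mul, show e - a + -e = -a by ring] at h
  exact h

/-- Power series in `1 / c` as series near infinite central charge. -/
def expand : PowerSeries ℝ →+* LargeC := HahnSeries.ofPowerSeries ℚ ℝ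

theorem expand_C (r : ℝ) : expand (PowerSeries.C r) = HahnSeries.C r := HahnSeries.ofPowerSeries_C r

theorem expand_X_mul : expand PowerSeries.X * cPow 1 = 1 := by
  rw [expand, HahnSeries.ofPowerSeries_X, cPow, HahnSeries.single_mul_single, mul_one, add_neg_cancel]
  rfl

theorem coeff_expand_zero (f : PowerSeries ℝ) : (expand f).coeff 0 = PowerSeries.constantCoeff f := by
  have := HahnSeries.ofPowerSeries_apply_coeff (Γ := ℚ) f 0
  rwa [Nat.cast_zero, PowerSeries.coeff_zero_eq_constantCoeff_apply] at this

theorem exists_nat_of_coeff_expand {f : PowerSeries ℝ} {r : ℚ} (h : (expand f).coeff r ≠ 0) :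
    ∃ j : ℕ, r = j := by
  by_contra! h1
  refine h ?_
  rw [expand, HahnSeries.ofPowerSeries_apply]
  refine HahnSeries.embDomain_of_notMem_range ?_
  rintro ⟨j, hj⟩
  exact h1 j hj.symm

/-- Exponentiation evaluated at `ε = δ c ^ (α - 1)`, where `c ε ^ k = δ ^ k c ^ (k α - k + 1)`. The
series `u` and the degree bounds `N` serve all `δ` and `α` at once, which is what relates different
values of `α`. -/
theorem exists_expansion : ∃ (N : ℕ → ℕ) (u : ℕ → ℕ → PowerSeries ℝ),
    (∀ n k, k < 2 → u n k = 0) ∧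
    (∀ n : ℕ, PowerSeries.constantCoeff (u n 2) = (12 * (n - 1) / (n * (n + 1)) : ℝ)) ∧
    ∀ (δ : ℝ) (α : ℚ) (n K : ℕ) (a : ℚ), N n ≤ K →
      (PowerSeries.coeff n (logVacuumBlock δ α)).coeff (-a)
        = ∑ k ∈ Finset.range K, δ ^ k * (expand (u n k)).coeff (k * α - k + 1 - a) := by
  let _ : Algebra ℝ LargeC := (HahnSeries.C : ℝ →+* LargeC).toAlgebra
  obtain ⟨g, hg, hg0, hg2⟩ := exists_block_eq (F := LargeC) (η := expand) (c := cPow 1)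
    expand_C HahnSeries.ofPowerSeries_injective expand_X_mul
  -- The factor `n⁻¹` undoes `z d/dz`. At `n = 0` it is zero, which is correct because the logarithm
  -- has no constant term.
  refine ⟨fun n => (g n).natDegree + 1, fun n k => PowerSeries.C (n : ℝ)⁻¹ * (g n).coeff k,
    fun n k hk => ?_, fun n => ?_, fun δ α n K a hK => ?_⟩
  · simp only [Polynomial.X_pow_dvd_iff.1 (hg0 n) k hk, mul_zero]
  · rw [map_mul, hg2, PowerSeries.constantCoeff_C]
    rcases Nat.eq_zero_or_pos n with rfl | hn
    · simp
    · have : (n : ℝ) ≠ 0 := by positivity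
      rw [inv_mul_cancel_left₀ this]
  · simp only at hK
    have hε : HahnSeries.C δ * cPow (α - 1) * cPow 1 = HahnSeries.C δ * cPow α := by
      rw [mul_assoc, cPow_mul, sub_add_cancel]
    obtain ⟨h0, h1⟩ := hg (HahnSeries.C δ * cPow (α - 1))
    rw [hε] at h0 h1
    rw [← theta_logOf h0, mul_left_comm] at h1
    have hu : IsUnit (block (HahnSeries.C δ * cPow α) 0 (cPow 1)) := by
      rw [PowerSeries.isUnit_iff_constantCoeff, h0]; exact isUnit_one
    have h2 := congrArg (PowerSeries.coeff n) (hu.mul_left_cancel h1)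
    rw [PowerSeries.coeff_C_mul, coeff_theta, PowerSeries.coeff_mk] at h2
    set L := PowerSeries.coeff n (logVacuumBlock δ α) with hL
    have h3 : (n : LargeC) * L = ∑ k ∈ Finset.range K,
        cPow (k * α - k + 1) * (HahnSeries.C (δ ^ k) * expand ((g n).coeff k)) := by
      have h4 : (n : LargeC) * L = cPow 1 * (g n).eval₂ expand (HahnSeries.C δ * cPow (α - 1)) := by
        rw [← h2]
        change (n : LargeC) * L = cPow 1 * (expand PowerSeries.X * (n * L))
        linear_combination (-(n : LargeC) * L) * expand_X_mul
      rw [h4, Polynomial.eval₂_eq_sum_range' expand (n := K) (by omega), Finset.mul_sum]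
      refine Finset.sum_congr rfl fun k _ => ?_
      rw [mul_pow, cPow_pow, show (k * α - k + 1 : ℚ) = 1 + k * (α - 1) by ring, ← cPow_mul, map_pow]
      ring
    have h5 : L = ∑ k ∈ Finset.range K, cPow (k * α - k + 1) *
        (HahnSeries.C (δ ^ k) * expand (PowerSeries.C (n : ℝ)⁻¹ * (g n).coeff k)) := by
      rcases Nat.eq_zero_or_pos n with rfl | hn
      · rw [hL, logVacuumBlock, vacuumBlock, PowerSeries.coeff_zero_eq_constantCoeff_apply,
          PowerSeries.constantCoeff_logOf h0]
        simp
      · have h6 : HahnSeries.C ((n : ℝ)⁻¹) * (n : LargeC) = 1 := by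
          rw [← map_natCast (HahnSeries.C : ℝ →+* LargeC), ← map_mul, inv_mul_cancel₀ (by positivity),
            map_one]
        rw [← one_mul L, ← h6, mul_assoc, h3, Finset.mul_sum]
        refine Finset.sum_congr rfl fun k _ => ?_
        rw [map_mul, expand_C]; ring
    rw [h5, HahnSeries.coeff_sum]
    refine Finset.sum_congr rfl fun k _ => ?_
    rw [coeff_cPow_mul, HahnSeries.C_mul_eq_smul, HahnSeries.coeff_smul, smul_eq_mul]

/-- The terms of non-negative degree of the logarithmic vacuum block for `α < 1`. -/
theorem exists_expansion_nonneg : ∃ (N : ℕ → ℕ) (v : ℕ → ℕ → ℝ),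
    (∀ n : ℕ, v n 2 = (12 * (n - 1) / (n * (n + 1)) : ℝ)) ∧
    ∀ (δ : ℝ) (α a : ℚ) (n K : ℕ), α < 1 → 0 ≤ a → N n ≤ K →
      (PowerSeries.coeff n (logVacuumBlock δ α)).coeff (-a)
        = ∑ k ∈ Finset.range K, if 2 ≤ k ∧ k * α - k + 1 = a then δ ^ k * v n k else 0 := by
  obtain ⟨N, u, hu0, hu2, hu⟩ := exists_expansion
  refine ⟨N, fun n k => PowerSeries.constantCoeff (u n k), hu2,
    fun δ α a n K hα ha hK => ?_⟩
  rw [hu δ α n K a hK]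
  refine Finset.sum_congr rfl fun k _ => ?_
  split_ifs with h
  · rw [h.2, sub_self, coeff_expand_zero]
  · by_contra h1
    have hk : 2 ≤ k := by
      by_contra hk
      rw [hu0 n k (by omega), map_zero] at h1
      exact h1 (mul_zero _)
    obtain ⟨j, hj⟩ := exists_nat_of_coeff_expand (right_ne_zero_of_mul h1)
    have hk' : (2 : ℚ) ≤ k := by exact_mod_cast hk
    -- For `k ≥ 2` and `α < 1` the exponent `1 - k (1 - α)` is below 1, so after lowering it by `j`
    -- it can be non-negative only for `j = 0`.
    have hj1 : (j : ℚ) < 1 := by rw [← hj]; nlinarith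
    have hj0 : j = 0 := by
      have : j < 1 := by exact_mod_cast hj1
      omega
    rw [hj0, Nat.cast_zero] at hj
    exact h ⟨hk, sub_eq_zero.1 hj⟩

theorem coeff_vacuumCoeff {N : ℕ → ℕ} {v : ℕ → ℕ → ℝ}
    (hv : ∀ (δ : ℝ) (α a : ℚ) (n K : ℕ), α < 1 → 0 ≤ a → N n ≤ K →
      (PowerSeries.coeff n (logVacuumBlock δ α)).coeff (-a)
        = ∑ k ∈ Finset.range K, if 2 ≤ k ∧ k * α - k + 1 = a then δ ^ k * v n k else 0)
    (δ : ℝ) {α : ℚ} (hα : α < 1) {k : ℕ} (hk : 2 ≤ k) (ha : 0 ≤ k * α - k + 1) (n : ℕ) :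
    PowerSeries.coeff n (vacuumCoeff δ α (k * α - k + 1)) = δ ^ k * v n k := by
  -- The range is enlarged so that it contains `k`. For `α ≠ 1` the exponents are distinct, so no
  -- other index contributes.
  rw [vacuumCoeff, PowerSeries.coeff_mk, hv δ α _ n (max (N n) (k + 1)) hα ha (le_max_left _ _),
    Finset.sum_eq_single k]
  · rw [if_pos ⟨hk, rfl⟩]
  · intro l _ hl
    refine if_neg fun h => hl ?_
    have h1 : ((l : ℚ) - k) * (1 - α) = 0 := by linear_combination -h.2
    exact_mod_cast sub_eq_zero.1 ((mul_eq_zero.1 h1).resolve_right (by linarith))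
  · intro h
    exact absurd (Finset.mem_range.2 (by omega)) h

/-- At `α = m / (m + 1)` the exponent `k α - k + 1` vanishes exactly for `k = m + 1`. -/
theorem coeff_isolatedCoeff {N : ℕ → ℕ} {v : ℕ → ℕ → ℝ}
    (hv : ∀ (δ : ℝ) (α a : ℚ) (n K : ℕ), α < 1 → 0 ≤ a → N n ≤ K →
      (PowerSeries.coeff n (logVacuumBlock δ α)).coeff (-a)
        = ∑ k ∈ Finset.range K, if 2 ≤ k ∧ k * α - k + 1 = a then δ ^ k * v n k else 0)
    (δ : ℝ) {m : ℕ} (hm : 1 ≤ m) (n : ℕ) :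
    PowerSeries.coeff n (isolatedCoeff δ m) = δ ^ (m + 1) * v n (m + 1) := by
  have hm' : (0 : ℚ) < (m : ℚ) + 1 := by positivity
  have h0 : ((m + 1 : ℕ) : ℚ) * ((m : ℚ) / (m + 1)) - (m + 1 : ℕ) + 1 = 0 := by
    push_cast; field_simp; ring
  rw [isolatedCoeff, ← coeff_vacuumCoeff hv δ (α := (m : ℚ) / (m + 1)) (k := m + 1)
    (by rw [div_lt_one hm']; linarith) (by omega) h0.ge, h0]

theorem coeff_hypergeometric (m : ℕ) : PowerSeries.coeff m (hypergeometric 2 2 4)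
    = 6 * ((m : ℝ) + 1) / ((m + 2) * (m + 3)) := by
  have h2 : ∀ m : ℕ, (ascPochhammer ℝ m).eval 2 = (m + 1).factorial := by
    intro m
    induction m with
    | zero => simp
    | succ m ih => rw [ascPochhammer_succ_eval, ih, Nat.factorial_succ (m + 1)]; push_cast; ring
  have h4 : ∀ m : ℕ, 6 * (ascPochhammer ℝ m).eval 4 = (m + 3).factorial := by
    intro m
    induction m with
    | zero => norm_num [Nat.factorial]
    | succ m ih =>
      rw [ascPochhammer_succ_eval, ← mul_assoc, ih, show m + 1 + 3 = m + 3 + 1 by rfl,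
        Nat.factorial_succ (m + 3)]
      push_cast; ring
  have h4' : (ascPochhammer ℝ m).eval 4 = (m + 3).factorial / 6 := by
    rw [← h4]; ring
  rw [hypergeometric, PowerSeries.coeff_mk, ordinaryHypergeometricCoefficient, h2, h4',
    Nat.factorial_succ (m + 2), Nat.factorial_succ (m + 1), Nat.factorial_succ m]
  have : (m.factorial : ℝ) ≠ 0 := by positivity
  push_cast
  field_simp
  ring

end

end VirasoroBlock

/-! ### Comparison of exponents -/

theorem mainTheorem5 (δ : ℝ) :
    -- reconstruction of the classical vacuum block from the isolated coefficients
    (∀ (M : ℕ) (α : ℚ), 1 ≤ M → ((M : ℚ) - 1) / M ≤ α → α < (M : ℚ) / (M + 1) →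
      VirasoroBlock.classicalVacuumBlock δ α =
        ∑ m ∈ Finset.Icc 1 (M - 1),
          PowerSeries.C (VirasoroBlock.cPow (((m : ℚ) + 1) * α - m)) *
            PowerSeries.map HahnSeries.C (VirasoroBlock.isolatedCoeff δ m)) ∧
    -- the term of minimal non-zero degree is the isolated coefficient at the left endpoint
    (∀ (M : ℕ) (α : ℚ), 2 ≤ M → ((M : ℚ) - 1) / M < α → α ≤ (M : ℚ) / (M + 1) →
      (∀ a : ℚ, 0 < a → VirasoroBlock.vacuumCoeff δ α a ≠ 0 → (M : ℚ) * α - (M - 1) ≤ a) ∧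
      VirasoroBlock.vacuumCoeff δ α ((M : ℚ) * α - (M - 1)) =
        VirasoroBlock.isolatedCoeff δ (M - 1)) ∧
    -- the first isolated coefficient
    VirasoroBlock.isolatedCoeff δ 1 =
      PowerSeries.C (2 * δ ^ 2) * PowerSeries.X ^ 2 * VirasoroBlock.hypergeometric 2 2 4 := by
  obtain ⟨N, v, hv2, hv⟩ := VirasoroBlock.exists_expansion_nonneg
  refine ⟨fun M α hM hα hα' => ?_, fun M α hM hα hα' => ⟨fun a ha h => ?_, ?_⟩, ?_⟩
  · have hM' : (1 : ℚ) ≤ M := by exact_mod_cast hM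
    have hα1 : α < 1 := hα'.trans (by rw [div_lt_one (by positivity)]; linarith)
    rw [div_le_iff₀ (by positivity)] at hα
    rw [lt_div_iff₀ (by positivity)] at hα'
    ext n b
    obtain ⟨a, rfl⟩ : ∃ a, b = -a := ⟨-b, (neg_neg b).symm⟩
    rw [VirasoroBlock.classicalVacuumBlock, PowerSeries.coeff_mk, map_sum, HahnSeries.coeff_sum]
    have hR : ∀ m ∈ Finset.Icc 1 (M - 1), (PowerSeries.coeff n
        (PowerSeries.C (VirasoroBlock.cPow (((m : ℚ) + 1) * α - m)) *
          PowerSeries.map HahnSeries.C (VirasoroBlock.isolatedCoeff δ m))).coeff (-a)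
        = if ((m : ℚ) + 1) * α - m = a then δ ^ (m + 1) * v n (m + 1) else 0 := by
      intro m hm
      rw [PowerSeries.coeff_C_mul, PowerSeries.coeff_map, VirasoroBlock.coeff_cPow_mul,
        VirasoroBlock.coeff_isolatedCoeff hv δ (Finset.mem_Icc.1 hm).1, HahnSeries.C_apply,
        HahnSeries.coeff_single]
      simp only [sub_eq_zero]
    rw [Finset.sum_congr rfl hR]
    by_cases ha : 0 ≤ a
    · have hp : (VirasoroBlock.prin (PowerSeries.coeff n
          (VirasoroBlock.logVacuumBlock δ α))).coeff (-a)
          = (PowerSeries.coeff n (VirasoroBlock.logVacuumBlock δ α)).coeff (-a) :=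
        if_pos (by linarith)
      rw [hp, hv δ α a n (max (N n) (M + 1)) hα1 ha (le_max_left _ _)]
      symm
      -- The isolated coefficient with index `m` is the term of degree `k = m + 1` in `ε`. Terms
      -- with `k ≥ M + 1` have negative exponent since `α < M / (M + 1)`.
      refine Finset.sum_of_injOn (· + 1) (fun _ _ _ _ h => by simpa using h) (fun m hm => ?_)
        (fun k _ hk => ?_) (fun m hm => ?_)
      · have := Finset.mem_Icc.1 hm
        exact Finset.mem_coe.2 (Finset.mem_range.2 (by simp only; omega))
      · refine if_neg fun h => hk ⟨k - 1, ?_, by simp only; omega⟩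
        rw [Finset.mem_coe, Finset.mem_Icc]
        suffices k < M + 1 by omega
        by_contra hk1
        have hk2 : (M : ℚ) + 1 ≤ k := by exact_mod_cast not_lt.1 hk1
        nlinarith [h.2]
      · have := Finset.mem_Icc.1 hm
        refine if_congr ?_ rfl rfl
        push_cast
        constructor
        · intro h
          exact ⟨by omega, by linear_combination h⟩
        · intro h
          linear_combination h.2
    · have hp : (VirasoroBlock.prin (PowerSeries.coeff n
          (VirasoroBlock.logVacuumBlock δ α))).coeff (-a) = 0 := if_neg (by linarith)
      rw [hp, Finset.sum_eq_zero]
      intro m hm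
      refine if_neg fun h => ha ?_
      -- The lower bound on `α` makes every exponent with `m + 1 ≤ M` non-negative, so no
      -- reconstructed term falls outside the principal part.
      have h1 : (m : ℚ) + 1 ≤ M := by
        have := Finset.mem_Icc.1 hm
        exact_mod_cast (show m + 1 ≤ M by omega)
      rw [← h]
      nlinarith
  · have hM' : (2 : ℚ) ≤ M := by exact_mod_cast hM
    have hα1 : α < 1 := hα'.trans_lt (by rw [div_lt_one (by positivity)]; linarith)
    rw [le_div_iff₀ (by positivity)] at hα'
    obtain ⟨n, hn⟩ : ∃ n, PowerSeries.coeff n (VirasoroBlock.vacuumCoeff δ α a) ≠ 0 := by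
      by_contra! h1
      exact h (PowerSeries.ext h1)
    rw [VirasoroBlock.vacuumCoeff, PowerSeries.coeff_mk, hv δ α a n (N n) hα1 ha.le le_rfl] at hn
    obtain ⟨k, -, hk⟩ := Finset.exists_ne_zero_of_sum_ne_zero hn
    have hk' := (ite_ne_right_iff.1 hk).1.2
    -- Exponents decrease with `k` and are non-positive from `M + 1` on, so the least positive one
    -- can only come from `k = M`.
    have hkM : k ≤ M := by
      by_contra hk1
      have hk2 : (M : ℚ) + 1 ≤ k := by exact_mod_cast Nat.succ_le_of_lt (not_le.1 hk1)
      nlinarith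
    have hkM' : (k : ℚ) ≤ M := by exact_mod_cast hkM
    nlinarith
  · have hM' : (2 : ℚ) ≤ M := by exact_mod_cast hM
    have hα1 : α < 1 := hα'.trans_lt (by rw [div_lt_one (by positivity)]; linarith)
    rw [div_lt_iff₀ (by positivity)] at hα
    ext n
    rw [VirasoroBlock.coeff_isolatedCoeff hv δ (by omega), Nat.sub_add_cancel (by omega),
      ← VirasoroBlock.coeff_vacuumCoeff hv δ hα1 hM (by linarith), sub_add]
  · ext n
    rw [VirasoroBlock.coeff_isolatedCoeff hv δ le_rfl, hv2, mul_assoc, PowerSeries.coeff_C_mul,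
      PowerSeries.coeff_X_pow_mul']
    split_ifs with hn
    · obtain ⟨m, rfl⟩ := Nat.exists_eq_add_of_le' hn
      rw [Nat.add_sub_cancel, VirasoroBlock.coeff_hypergeometric]
      push_cast
      field_simp
      ring
    -- The closed form for `v n 2` also vanishes at `n = 0`, by the convention for division by zero.
    · interval_cases n <;> simp
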